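/- **Setting.** Let $G$ be a complex connected semisimple linear algebraic group with maximal torus $T$, Borel subgroup $B\supset T$, root system $\Phi$, simple roots $\Delta$, Weyl group $W$ with length $l$ and longest element $w_0$; let $P\supset B$ be the parabolic subgroup given by $\Delta_P\subset\Delta$, $W_P$ its Weyl group, $\Phi_P^+$ its positive roots, and $W^P$ the set of minimal length representatives of $W/W_P$. For $w\in W^P$ let $w^\vee$ be the minimal length representative of $w_0wW_P$ and $c(w)=l(w^\vee)$; let $\overline w_0$ be the representative of $w_0W_P$. For $\alpha\in\Phi^+\smallsetminus\Phi_P^+$ let $h_\alpha$ be its coroot, $\omega_\beta$ the fundamental weights, $d(\alpha)=(h_\alpha(\omega_\beta))_{\beta\in\Delta\smallsetminus\Delta_P}$; put $n_\beta=\deg q_\beta=\sum_{\gamma\in\Phi^+\smallsetminus\Phi_P^+}h_\beta(\gamma)$ and $n(\alpha)=\sum_\beta n_\beta h_\alpha(\omega_\beta)$. Let $\Lambda=\mathbb Z[x_1,\dots,x_m]$ be the polynomial ring in the negative simple roots and $R(\Lambda)$ its fraction field. For $\beta \in \Delta\smallsetminus\Delta_P$ and $w\in W^P$ let $c_{s(\beta),w}^w=w_0\big(\sum_{j:\,\beta_{i_j}=\beta}s_{i_1}\cdots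 s_{i_{j-1}}(\beta)\big)$, where $s_{i_1}\cdots s_{i_k}$ is a reduced word of $w^\vee$, and let $F_{w,u}(\beta)=c_{s(\beta),w}^w-c_{s(\beta),u}^u$. Consider families $c_{u,v}^{w,d}\in R(\Lambda)$ ($u,v,w\in W^P$, $d=(d_\beta)\in\mathbb N^{\Delta\smallsetminus\Delta_P}$) in which $c_{u,v}^{w,d}$ is a homogeneous rational function of degree $c(u)+c(v)-c(w)-\sum n_\beta d_\beta$, and such that (a) $c_{\overline w_0,w}^{w,d}$ is $1$ if $d=0$ and $0$ otherwise; (b) $c_{u,v}^{w,d}=c_{v,u}^{w,d}$; (c) for $u\neq w$ and every $\beta\in\Delta\smallsetminus\Delta_P$ with $F_{w,u}(\beta)\ne0$, $$c_{u,v}^{w,d}=\frac{\sum h_\alpha(\omega_\beta)c_{u_1,v}^{w,d}-\sum h_\alpha(\omega_\beta)c_{u,v}^{w_1,d}+\sum h_\alpha(\omega_\beta)c_{u_2,v}^{w,d-d(\alpha)}-\sum h_\alpha(\omega_\beta)c_{u,v}^{w_2,d-d(\alpha)}}{F_{w,u}(\beta)},$$ where $\alpha$ runs over $\Phi^+\smallsetminus\Phi_P^+$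 and $u_1,w_1,u_2,w_2$ over $W^P$, with $u_1=us_\alpha$, $c(u_1)=c(u)+1$ in the first sum; $w=w_1s_\alpha$, $c(w)=c(w_1)+1$ in the second; $d\ge d(\alpha)$, $u_2W_P=us_\alpha W_P$, $c(u_2)=c(u)+1-n(\alpha)$ in the third; $d\geq d(\alpha)$, $wW_P=w_2s_\alpha W_P$, $c(w)=c(w_2)+1-n(\alpha)$ in the fourth. (The equivariant quantum Littlewood–Richardson (EQLR) coefficients of $G/P$ form such a family.) **Reversed Bruhat order and path sums.** Write $u\prec w$ for the reflexive and transitive closure on $W^P$ of the relation "$w_2=w_1s_\alpha$ for some $\alpha\in\Phi^+\smallsetminus\Phi^+_P$, and $c(w_2)>c(w_1)$". For $u\prec w$ an assignment $f$ picks, for each $v\ne w$ with $u\prec v\prec w$, some $\beta(v)\in\Delta\smallsetminus\Delta_P$ such that $F_{w,v}(\beta(v))$ is a nonzero combination of the $x_i$ with nonnegative coefficients. $R(u,w;f)$ is the sum, over all chains $u=u_0,\,u_1=u_0s_{\alpha_1},\dots,u_k=u_{k-1}s_{\alpha_k}=w$ in $W^P$ with $\alpha_i\in\Phi^+\smallsetminus\Phi_P^+$,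 $c(u_i)=c(u_{i-1})+1$ and $u_i\prec w$, of $\prod_i h_{\alpha_i}(\omega_{\beta(u_{i-1})})/F_{w,u_{i-1}}(\beta(u_{i-1}))$. **Theorem.** The EQLR coefficients are uniquely and algorithmically determined by homogeneity and (a), (b), (c). That is: 1. There is at most one family with these properties. 2. For all $u\ne w$ in $W^P$ there is $\beta\in\Delta\smallsetminus\Delta_P$ with $F_{w,u}(\beta)\neq0$, and for every $w$ there is an assignment $f_w$ for $\overline w_0\prec w$ with $R(\overline w_0,w;f_w)\ne0$. 3. For any such choices the following algorithm is effective (it is given by a computable function from $(u,v,w,d)$ to pairs consisting of a numerator and a nonzero denominator) and its output is the family $c$, whenever $c$ has these properties. It proceeds by induction on $d$. For fixed $d$ it first computes $$c_{w,w}^{w,d}=\frac{\delta_{d,0}-E'(\overline w_0,w;f_w,d)}{R(\overline w_0,w;f_w)},$$ where $E'$ is an explicit $R(\Lambda)$-linear expression in the coefficients of multidegree smaller than $d$, obtained by repeated use of (b) and (c); in particular $c_{w,w}^{w,0}=1/R(\overline w_0,w;f_w)$. It then computes all other $c_{u,v}^{w,d}$ by descending induction on the polynomial degree $c(u)+c(v)-c(w)-\sum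 n_\beta d_\beta$, applying (c) if $u\ne w$, and (b) followed by (c) if $u=w\neq v$. -/

import Mathlib

open scoped Classical

/-!
Combinatorial setting. A complex connected semisimple group `G` with maximal torus and Borel
subgroup is recorded by its root system `P` (reduced, crystallographic) with a base `b` (the simple
roots), and a parabolic subgroup containing the Borel subgroup by the subset `J` of simple roots.
-/

set_option linter.unusedSectionVars false

namespace EQLR

noncomputable section

variable {ι M N : Type*} [Fintype ι] [AddCommGroup M] [Module ℚ M] [AddCommGroup N] [Module ℚ N]
  {P : RootPairing ι ℚ M N} [P.IsRootSystem] [P.IsCrystallographic] [P.IsReduced]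

/-! ### The Weyl group, lengths, minimal length representatives -/

instance finite_weylGroup : Finite P.weylGroup := by
  refine Finite.of_injective
    (fun w : P.weylGroup => RootPairing.Equiv.indexHom P (w : P.Aut)) ?_
  intro v w h
  apply Subtype.ext
  apply RootPairing.Equiv.weightHom_injective P
  apply LinearEquiv.toLinearMap_injective
  refine LinearMap.ext_on_range (v := P.root) RootPairing.IsRootSystem.span_root_eq_top ?_
  intro i
  have h1 := RootPairing.Equiv.root_indexEquiv_eq_smul (P := P) i (v : P.Aut)
  have h2 := RootPairing.Equiv.root_indexEquiv_eq_smul (P := P) i (w : P.Aut)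
  have h3 : (v : P.Aut).indexEquiv i = (w : P.Aut).indexEquiv i :=
    congrArg (fun e : ι ≃ ι => e i) h
  rw [h3] at h1
  exact h1.symm.trans h2

variable (b : P.Base)

/-- The product of the simple reflections in a word. -/
def wordProd (l : List b.support) : P.weylGroup :=
  (l.map fun i => RootPairing.weylGroup.ofIdx P (i : ι)).prod

theorem ofIdx_reflectionPerm (i j : ι) :
    RootPairing.weylGroup.ofIdx P (P.reflectionPerm i j) =
      RootPairing.weylGroup.ofIdx P i * RootPairing.weylGroup.ofIdx P j *
        RootPairing.weylGroup.ofIdx P i := by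
  apply Subtype.ext
  apply RootPairing.Equiv.weightHom_injective P
  refine LinearEquiv.ext fun x => ?_
  change P.reflection (P.reflectionPerm i j) x =
    P.reflection i (P.reflection j (P.reflection i x))
  rw [P.reflection_reflectionPerm]
  rfl

theorem exists_word (w : P.weylGroup) : ∃ l : List b.support, wordProd b l = w := by
  have key : ∀ i : ι, ∃ l : List b.support, wordProd b l = RootPairing.weylGroup.ofIdx P i := by
    intro i
    refine b.induction_reflect i (p := fun i =>
      ∃ l : List b.support, wordProd b l = RootPairing.weylGroup.ofIdx P i) ?_ ?_ ?_
    · rintro i ⟨l, hl⟩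
      refine ⟨l ++ (l ++ l), ?_⟩
      rw [ofIdx_reflectionPerm, ← hl]
      simp [wordProd, mul_assoc]
    · intro i hi
      exact ⟨[⟨i, hi⟩], by simp [wordProd]⟩
    · rintro i j ⟨l, hl⟩ hj
      refine ⟨[⟨j, hj⟩] ++ (l ++ [⟨j, hj⟩]), ?_⟩
      rw [ofIdx_reflectionPerm, ← hl]
      simp [wordProd, mul_assoc]
  obtain ⟨w, hw⟩ := w
  induction hw using RootPairing.weylGroup.induction with
  | mem i => exact key i
  | one => exact ⟨[], rfl⟩
  | mul x y hx hy h1 h2 =>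
    obtain ⟨l, hl⟩ := h1
    obtain ⟨l', hl'⟩ := h2
    refine ⟨l ++ l', ?_⟩
    have : wordProd b (l ++ l') = wordProd b l * wordProd b l' := by simp [wordProd]
    rw [this, hl, hl']
    rfl

/-- The length `l(w)`: the least number of simple reflections with product `w`. -/
def length (w : P.weylGroup) : ℕ :=
  sInf {n | ∃ l : List b.support, wordProd b l = w ∧ l.length = n}

theorem exists_reducedWord (w : P.weylGroup) :
    ∃ l : List b.support, wordProd b l = w ∧ l.length = length b w := by
  obtain ⟨l, hl⟩ := exists_word b w
  exact Nat.sInf_mem (s := {n | ∃ l : List b.support, wordProd b l = w ∧ l.length = n})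
    ⟨l.length, l, hl, rfl⟩

/-- A reduced word of `w`. -/
def reducedWord (w : P.weylGroup) : List b.support :=
  (exists_reducedWord b w).choose

theorem exists_longest : ∃ w : P.weylGroup, ∀ v, length b v ≤ length b w :=
  Finite.exists_max (length b)

/-- The longest element `w₀`. -/
def longest : P.weylGroup := (exists_longest b).choose

variable (J : Set b.support)

/-- The Weyl group `W_P` of the parabolic subgroup. -/
def parabolicWeyl : Subgroup P.weylGroup :=
  Subgroup.closure ((fun i : b.support => RootPairing.weylGroup.ofIdx P (i : ι)) '' J)

/-- `W^P`: the representatives of minimal length of the cosets `w W_P`. -/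
abbrev MinRep : Type _ :=
  {w : P.weylGroup // ∀ v ∈ parabolicWeyl b J, length b w ≤ length b (w * v)}

instance : Fintype (MinRep b J) := Fintype.ofFinite _

theorem exists_minRep (w : P.weylGroup) :
    ∃ u : MinRep b J, w⁻¹ * (u : P.weylGroup) ∈ parabolicWeyl b J := by
  obtain ⟨⟨v, hv⟩, hmin⟩ :=
    Finite.exists_min (fun v : parabolicWeyl b J => length b (w * (v : P.weylGroup)))
  refine ⟨⟨w * v, fun v' hv' => ?_⟩, by simpa using hv⟩
  simpa [mul_assoc] using hmin ⟨v * v', mul_mem hv hv'⟩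

/-- The representative of minimal length of the coset `w W_P`. -/
def minRep (w : P.weylGroup) : MinRep b J := (exists_minRep b J w).choose

/-- The dual `w^∨`: the minimal length representative of `w₀ w W_P`. -/
def dual (w : MinRep b J) : MinRep b J := minRep b J (longest b * w)

/-- The codimension `c(w) = l(w^∨)`, the complex degree of the Schubert class `σ(w)`. -/
def codim (w : MinRep b J) : ℕ := length b (dual b J w : P.weylGroup)

/-- The representative `w̄₀` of `w₀`; it indexes the unit. -/
def unitRep : MinRep b J := minRep b J (longest b)

/-- The dimension of `G/P`, as the largest codimension of a representative. -/
def maxCodim : ℕ := Finset.univ.sup (codim b J)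

/-! ### Roots, multidegrees and degrees of the quantum parameters -/

/-- `Δ ∖ Δ_P`. -/
abbrev DivRoot : Type _ := {β : b.support // β ∉ J}

/-- Multidegrees `d = (d_β)`. -/
abbrev Deg : Type _ := DivRoot b J → ℕ

/-- `α ∈ Φ⁺ ∖ Φ⁺_P`: a positive root that is not a combination of roots in `Δ_P`. -/
def IsOuter (α : ι) : Prop :=
  b.IsPos α ∧ P.root α ∉ Submodule.span ℚ ((fun i : b.support => P.root i) '' J)

/-- The fundamental weight `ω_β`, dual to the basis of simple coroots. -/
def fundWeight (β : b.support) : M :=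
  P.toLinearMap.toPerfPair.symm (b.toCoweightBasis.coord β)

/-- `h_α(ω_β)`. For a positive root `α` this rational number is a nonnegative integer (see
`cast_coef`), so that taking the integer part changes nothing. -/
def coef (α : ι) (β : b.support) : ℕ :=
  ⌊P.toLinearMap (fundWeight b β) (P.coroot α)⌋₊

theorem fundWeight_apply (β : b.support) (x : N) :
    P.toLinearMap (fundWeight b β) x = b.toCoweightBasis.repr x β := by
  have h : P.toLinearMap.toPerfPair (fundWeight b β) = b.toCoweightBasis.coord β := by
    simp [fundWeight]
  exact LinearMap.congr_fun h x

theorem exists_coroot_coef {α : ι} (hα : b.IsPos α) (β : b.support) :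
    ∃ n : ℕ, b.toCoweightBasis.repr (P.coroot α) β = n := by
  generalize hN : (b.height α).natAbs = k
  induction k using Nat.strongRecOn generalizing α with
  | ind k ih =>
    have simple : ∀ j ∈ b.support, ∃ n : ℕ, b.toCoweightBasis.repr (P.coroot j) β = n := by
      intro j hj
      have h := b.toCoweightBasis_repr_coroot ⟨j, hj⟩
      simp only at h
      rw [h, Finsupp.single_apply]
      split_ifs
      · exact ⟨1, by simp⟩
      · exact ⟨0, by simp⟩
    obtain ⟨j, hj, hpos⟩ := hα.exists_mem_support_pos_pairingIn
    rcases eq_or_ne α j with rfl | hne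
    · exact simple α hj
    · have hpos' : 0 < P.pairingIn ℤ α j := (P.zero_lt_pairingIn_iff' ℤ).mp hpos
      have hpos'' : 0 < P.pairingIn ℤ j α := hpos
      have hk := hα.reflectionPerm hj hne
      have hroot : P.root (P.reflectionPerm j α) =
          P.root α + (-P.pairingIn ℤ α j) • P.root j := by
        have := P.reflection_apply_root' ℤ (i := j) (j := α)
        rw [← P.root_reflectionPerm, sub_eq_add_neg, ← neg_smul] at this
        exact this
      have hh := b.height_add_zsmul hroot
      have h1 : b.height j = 1 := RootPairing.Base.height_one_of_mem_support hj
      rw [h1] at hh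
      have p1 := (RootPairing.Base.isPos_iff b).mp hk
      have p2 := (RootPairing.Base.isPos_iff b).mp hα
      simp only [smul_eq_mul, mul_one] at hh
      obtain ⟨n, hn⟩ := ih (b.height (P.reflectionPerm j α)).natAbs (by omega) hk rfl
      obtain ⟨n', hn'⟩ := simple j hj
      obtain ⟨p, hp⟩ := Int.eq_ofNat_of_zero_le hpos''.le
      have hcor : P.coroot (P.reflectionPerm j α) =
          P.coroot α - (p : ℚ) • P.coroot j := by
        rw [← P.reflectionPerm_coroot j α]
        congr 2
        have := P.algebraMap_pairingIn ℤ j α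
        rw [hp] at this
        simpa using this.symm
      refine ⟨n + p * n', ?_⟩
      have : P.coroot α = P.coroot (P.reflectionPerm j α) + (p : ℚ) • P.coroot j := by
        rw [hcor]; abel
      rw [this, map_add, map_smul, Finsupp.add_apply, Finsupp.smul_apply, hn, hn']
      simp

theorem cast_coef {α : ι} (hα : b.IsPos α) (β : b.support) :
    (coef b α β : ℚ) = P.toLinearMap (fundWeight b β) (P.coroot α) := by
  obtain ⟨n, hn⟩ := exists_coroot_coef b hα β
  rw [coef, fundWeight_apply, hn]
  simp

/-- The multidegree `d(α) = (h_α(ω_β))_β`. -/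
def rootDeg (α : ι) : Deg b J := fun β => coef b α β

/-- `n_β = deg q_β`: the pairing of `c₁(T(G/P))`, the sum of the roots in `Φ⁺ ∖ Φ⁺_P`, with the
coroot of `β`. -/
def qDeg (β : DivRoot b J) : ℤ :=
  ∑ γ : ι, if IsOuter b J γ then P.pairingIn ℤ γ (β : b.support) else 0

/-- `deg q^d = ∑ n_β d_β`. -/
def degQ (d : Deg b J) : ℤ := ∑ β, qDeg b J β * d β

/-! ### The ring `Λ = ℤ[x₁, …, x_m]`, its fraction field, and the linear forms -/

/-- The fraction field `R(Λ)` of the polynomial ring in the negative simple roots. -/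
abbrev RatFun : Type _ := FractionRing (MvPolynomial b.support ℤ)

/-- The negative simple root `x_i` in `R(Λ)`. -/
def negRoot (i : b.support) : RatFun b :=
  algebraMap (MvPolynomial b.support ℤ) (RatFun b) (MvPolynomial.X i)

/-- The linear extension of `β_i ↦ - x_i`, which reads an element of the root lattice as a
linear form in the negative simple roots. -/
def toForm : M →ₗ[ℚ] RatFun b := b.toWeightBasis.constr ℚ fun i => -negRoot b i

/-- `∑_{i_j = β} s_{i_1} ⋯ s_{i_{j-1}} (β)` for a word `s_{i_1} ⋯ s_{i_k}`. -/
def wordD (β : b.support) : List b.support → M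
  | [] => 0
  | i :: l => (if i = β then P.root i else 0) + P.reflection i (wordD β l)

/-- `D(s_β, w)`, computed from a reduced word of `w`. -/
def chevD (β : b.support) (w : P.weylGroup) : M := wordD b β (reducedWord b w)

/-- The equivariant Chevalley coefficient `c_{s(β),w}^w = φ(D(s_β, w^∨))`, where `φ` is induced by
the action of `w₀` on the roots. -/
def chevCoef (β : DivRoot b J) (w : MinRep b J) : RatFun b :=
  toForm b (longest b • chevD b β (dual b J w))

/-- `F_{w,u}(β) = c_{s(β),w}^w - c_{s(β),u}^u`. -/
def F (w u : MinRep b J) (β : DivRoot b J) : RatFun b := chevCoef b J β w - chevCoef b J β u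

/-- A linear combination of negative simple roots with nonnegative integer coefficients. -/
def IsNonnegForm (x : RatFun b) : Prop :=
  ∃ n : b.support → ℕ, x = ∑ i, (n i : RatFun b) * negRoot b i

/-- A homogeneous rational function of degree `k`: a quotient of homogeneous polynomials whose
degrees differ by `k`. -/
def IsHomogeneousRat (x : RatFun b) (k : ℤ) : Prop :=
  ∃ (p q : MvPolynomial b.support ℤ) (m n : ℕ), p.IsHomogeneous m ∧ q.IsHomogeneous n ∧ q ≠ 0 ∧
    (m : ℤ) - n = k ∧ x = algebraMap _ (RatFun b) p / algebraMap _ (RatFun b) q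

/-! ### The four sums of the recursion -/

/-- `u' = u s_α` with `α ∈ Φ⁺ ∖ Φ⁺_P` and `c(u') = c(u) + 1`. -/
def ClassicalStep (α : ι) (u u' : MinRep b J) : Prop :=
  IsOuter b J α ∧ (u' : P.weylGroup) = u * RootPairing.weylGroup.ofIdx P α ∧
    codim b J u' = codim b J u + 1

/-- `u'` is the representative of the coset `u s_α W_P`, `α ∈ Φ⁺ ∖ Φ⁺_P`, and
`c(u') = c(u) + 1 - n(α)`, where `n(α) = deg q^{d(α)}`. -/
def QuantumStep (α : ι) (u u' : MinRep b J) : Prop :=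
  IsOuter b J α ∧
    ((u : P.weylGroup) * RootPairing.weylGroup.ofIdx P α)⁻¹ * u' ∈ parabolicWeyl b J ∧
    (codim b J u' : ℤ) = codim b J u + 1 - degQ b J (rootDeg b J α)

/-- Families `c u v w d`, to be read as `c_{u,v}^{w,d}`. -/
abbrev Coeffs : Type _ :=
  MinRep b J → MinRep b J → MinRep b J → Deg b J → RatFun b

/-- `∑ h_α(ω_β) g(u s_α)` over the classical steps from `u`. -/
def upSum (β : DivRoot b J) (u : MinRep b J) (g : MinRep b J → RatFun b) : RatFun b :=
  ∑ α : ι, ∑ u₁, if ClassicalStep b J α u u₁ then (coef b α β : RatFun b) * g u₁ else 0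

/-- `∑ h_α(ω_β) g(w₁)` over the classical steps from some `w₁` to `w`. -/
def downSum (β : DivRoot b J) (w : MinRep b J) (g : MinRep b J → RatFun b) : RatFun b :=
  ∑ α : ι, ∑ w₁, if ClassicalStep b J α w₁ w then (coef b α β : RatFun b) * g w₁ else 0

/-- `∑ h_α(ω_β) g(u₂, d - d(α))` over the quantum steps from `u` to some `u₂` with `d ≥ d(α)`. -/
def qUpSum (β : DivRoot b J) (u : MinRep b J) (d : Deg b J)
    (g : MinRep b J → Deg b J → RatFun b) : RatFun b :=
  ∑ α : ι, ∑ u₂, if QuantumStep b J α u u₂ ∧ rootDeg b J α ≤ d then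
    (coef b α β : RatFun b) * g u₂ (d - rootDeg b J α) else 0

/-- `∑ h_α(ω_β) g(w₂, d - d(α))` over the quantum steps from some `w₂` to `w` with `d ≥ d(α)`. -/
def qDownSum (β : DivRoot b J) (w : MinRep b J) (d : Deg b J)
    (g : MinRep b J → Deg b J → RatFun b) : RatFun b :=
  ∑ α : ι, ∑ w₂, if QuantumStep b J α w₂ w ∧ rootDeg b J α ≤ d then
    (coef b α β : RatFun b) * g w₂ (d - rootDeg b J α) else 0

/-- The last two sums of the recursion; they only involve multidegrees smaller than `d`. -/
def lowTerm (c : Coeffs b J) (β : DivRoot b J) (u v w : MinRep b J) (d : Deg b J) : RatFun b :=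
  qUpSum b J β u d (fun u₂ e => c u₂ v w e) - qDownSum b J β w d (fun w₂ e => c u v w₂ e)

/-- The properties that determine the EQLR coefficients, for a family of rational functions. -/
structure IsEQLR (c : Coeffs b J) : Prop where
  /-- each coefficient is a homogeneous rational function of the expected degree -/
  homogeneous : ∀ u v w d, IsHomogeneousRat b (c u v w d)
    ((codim b J u : ℤ) + codim b J v - codim b J w - degQ b J d)
  /-- multiplication by the unit -/
  unit : ∀ w d, c (unitRep b J) w w d = if d = 0 then 1 else 0
  /-- commutativity -/
  comm : ∀ u v w d, c u v w d = c v u w d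
  /-- the recursion coming from the Chevalley rule and associativity -/
  recursion : ∀ (u v w : MinRep b J) (d : Deg b J) (β : DivRoot b J), u ≠ w → F b J w u β ≠ 0 →
    c u v w d =
      upSum b J β u (fun u₁ => c u₁ v w d) / F b J w u β
      - downSum b J β w (fun w₁ => c u v w₁ d) / F b J w u β
      + qUpSum b J β u d (fun u₂ e => c u₂ v w e) / F b J w u β
      - qDownSum b J β w d (fun w₂ e => c u v w₂ e) / F b J w u β

/-! ### The reversed Bruhat order and the path sums -/

/-- The reversed Bruhat order `u ≺ w` on `W^P` (it is reflexive). -/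
def Prec (u w : MinRep b J) : Prop :=
  Relation.ReflTransGen (fun w₁ w₂ : MinRep b J => ∃ α, IsOuter b J α ∧
    (w₂ : P.weylGroup) = w₁ * RootPairing.weylGroup.ofIdx P α ∧
    codim b J w₁ < codim b J w₂) u w

/-- `f` chooses `β(v) ∈ Δ ∖ Δ_P` for each vertex `v ≠ w` of the graph `Γ(u, w; f)`, in such a way
that `F_{w,v}(β(v))` is a nonzero, nonnegative combination of negative simple roots. (No choice is
possible or needed at `v = w`, from where no edge starts and where `F_{w,w} = 0`.) -/
def IsAssignment (u w : MinRep b J) (f : ∀ v : MinRep b J, v ≠ w → DivRoot b J) : Prop :=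
  ∀ (v : MinRep b J) (hv : v ≠ w), Prec b J u v → Prec b J v w →
    F b J w v (f v hv) ≠ 0 ∧ IsNonnegForm b (F b J w v (f v hv))

/-- The weight `h_α(ω_{β(v)}) / F_{w,v}(β(v))` of an edge of `Γ(u, w; f)` that starts at `v`. -/
def edgeWeight (w : MinRep b J) (f : ∀ v : MinRep b J, v ≠ w → DivRoot b J)
    (v : MinRep b J) (α : ι) : RatFun b :=
  if hv : v = w then 0 else (coef b α (f v hv) : RatFun b) / F b J w v (f v hv)

/-- The paths from `v` to `w` in the graph, as lists of pairs (label of an edge, end of the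
edge). -/
def IsPath (w : MinRep b J) : MinRep b J → List (ι × MinRep b J) → Prop
  | v, [] => v = w
  | v, (α, v') :: l => (ClassicalStep b J α v v' ∧ Prec b J v' w) ∧ IsPath w v' l

/-- The weight of a path that starts at `v`. -/
def pathWeight (w : MinRep b J) (f : ∀ v : MinRep b J, v ≠ w → DivRoot b J) :
    MinRep b J → List (ι × MinRep b J) → RatFun b
  | _, [] => 1
  | v, (α, v') :: l => edgeWeight b J w f v α * pathWeight w f v' l

theorem length_of_isPath (w : MinRep b J) (l : List (ι × MinRep b J)) :
    ∀ v, IsPath b J w v l → codim b J v + l.length = codim b J w := by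
  induction l with
  | nil => intro v h; simp only [IsPath] at h; simp [h]
  | cons a l ih =>
    intro v h
    obtain ⟨α, v'⟩ := a
    simp only [IsPath] at h
    have h1 := ih v' h.2
    have h2 := h.1.1.2.2
    simp only [List.length_cons]
    omega

theorem finite_paths (u w : MinRep b J) : {l | IsPath b J w u l}.Finite := by
  refine (List.finite_length_le (ι × MinRep b J) (codim b J w)).subset ?_
  intro l hl
  have := length_of_isPath b J w l u hl
  exact (show l.length ≤ codim b J w by omega)

/-- `R(u, w; f)`: the sum of the weights of all paths from `u` to `w`. -/
def pathSum (u w : MinRep b J) (f : ∀ v : MinRep b J, v ≠ w → DivRoot b J) : RatFun b :=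
  ∑ l ∈ (finite_paths b J u w).toFinset, pathWeight b J w f u l

/-! ### The algorithm -/

/-- A choice, for every `u ≠ w`, of the simple root used when the recursion is applied to a
coefficient `c_{u,v}^{w,d}`. -/
abbrev Selector : Type _ := ∀ u w : MinRep b J, u ≠ w → DivRoot b J

/-- The choice is admissible: one never divides by zero. -/
def IsSelector (sel : Selector b J) : Prop := ∀ u w h, F b J w u (sel u w h) ≠ 0

/-- One assignment for every `w`. -/
abbrev Assignments : Type _ := ∀ w v : MinRep b J, v ≠ w → DivRoot b J

/-- All the assignments are admissible on the interval from `w̄₀` to `w`, and `R(w̄₀, w; f)` is not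
zero, so that one can divide by it. -/
def IsGoodAssignments (f : Assignments b J) : Prop :=
  ∀ w, IsAssignment b J (unitRep b J) w (f w) ∧ pathSum b J (unitRep b J) w (f w) ≠ 0

/-- `E_{u,v,w}(d)` for `u ⊀ w`, by descending induction on `c(u) - c(w)`, from the values `c` of
smaller multidegree. The first argument bounds the number of nested steps. -/
def offTerm (sel : Selector b J) (c : Coeffs b J) (d : Deg b J) :
    ℕ → MinRep b J → MinRep b J → MinRep b J → RatFun b
  | 0, _, _, _ => 0
  | n + 1, u, v, w =>
    if h : u = w then 0 else
      (upSum b J (sel u w h) u (fun u₁ => offTerm sel c d n u₁ v w)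
        - downSum b J (sel u w h) w (fun w₁ => offTerm sel c d n u v w₁)
        + lowTerm b J c (sel u w h) u v w d) / F b J w u (sel u w h)

/-- `E_{u,v,w}(d)`: as `c(u) - c(w)` goes from `-dim` to `dim`, `2 dim + 1` nested steps suffice. -/
def offE (sel : Selector b J) (c : Coeffs b J) (d : Deg b J) (u v w : MinRep b J) : RatFun b :=
  offTerm b J sel c d (2 * maxCodim b J + 1) u v w

/-- `E'(u, w; f, d)` by ascending induction on `c(w) - c(u)`: the part of `c_{u,w}^{w,d}` that comes
from coefficients of smaller multidegree. -/
def pathTerm (sel : Selector b J) (c : Coeffs b J) (d : Deg b J) (w : MinRep b J)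
    (f : ∀ v : MinRep b J, v ≠ w → DivRoot b J) : ℕ → MinRep b J → RatFun b
  | 0, _ => 0
  | n + 1, u =>
    if h : u = w then 0 else
      (∑ α : ι, ∑ u₁, if ClassicalStep b J α u u₁ ∧ Prec b J u₁ w then
          edgeWeight b J w f u α * pathTerm sel c d w f n u₁ else 0)
      + (upSum b J (f u h) u (fun u₁ => if Prec b J u₁ w then 0 else offE b J sel c d u₁ w w)
          - downSum b J (f u h) w (fun w₁ => offE b J sel c d w u w₁)
          + lowTerm b J c (f u h) u w w d) / F b J w u (f u h)

/-- `E'(u, w; f, d)`. -/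
def pathE (sel : Selector b J) (c : Coeffs b J) (d : Deg b J) (u w : MinRep b J)
    (f : ∀ v : MinRep b J, v ≠ w → DivRoot b J) : RatFun b :=
  pathTerm b J sel c d w f (maxCodim b J + 1) u

/-- First step for the multidegree `d`: the value of `c_{w,w}^{w,d}`, found by solving
`c_{w̄₀,w}^{w,d} = R(w̄₀, w; f) c_{w,w}^{w,d} + E'(w̄₀, w; f, d)`. -/
def diagValue (sel : Selector b J) (f : Assignments b J) (c : Coeffs b J) (d : Deg b J)
    (w : MinRep b J) : RatFun b :=
  ((if d = 0 then 1 else 0) - pathE b J sel c d (unitRep b J) w (f w))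
    / pathSum b J (unitRep b J) w (f w)

/-- Second step for the multidegree `d`: all coefficients, by descending induction on the
polynomial degree, with commutativity if `u = w ≠ v`. -/
def fullTerm (sel : Selector b J) (f : Assignments b J) (c : Coeffs b J) (d : Deg b J) :
    ℕ → MinRep b J → MinRep b J → MinRep b J → RatFun b
  | 0, _, _, _ => 0
  | n + 1, u, v, w =>
    if hu : u = w then
      if hv : v = w then diagValue b J sel f c d w
      else
        (upSum b J (sel v w hv) v (fun v₁ => fullTerm sel f c d n v₁ u w)
          - downSum b J (sel v w hv) w (fun w₁ => fullTerm sel f c d n v u w₁)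
          + lowTerm b J c (sel v w hv) v u w d) / F b J w v (sel v w hv)
    else
      (upSum b J (sel u w hu) u (fun u₁ => fullTerm sel f c d n u₁ v w)
        - downSum b J (sel u w hu) w (fun w₁ => fullTerm sel f c d n u v w₁)
        + lowTerm b J c (sel u w hu) u v w d) / F b J w u (sel u w hu)

/-- The outer induction on the multidegree: after `k` rounds the table is filled for all `d` with
`∑ d_β < k`. The polynomial degree `c(u) + c(v) - c(w)`, up to `deg q^d`, goes from `-dim` to
`2 dim`, so that `3 dim + 1` nested steps suffice for each `d`. -/
def table (sel : Selector b J) (f : Assignments b J) : ℕ → Coeffs b J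
  | 0 => fun _ _ _ _ => 0
  | k + 1 => fun u v w d => fullTerm b J sel f (table sel f k) d (3 * maxCodim b J + 1) u v w

/-- The output of the algorithm. -/
def algorithm (sel : Selector b J) (f : Assignments b J) : Coeffs b J :=
  fun u v w d => table b J sel f (∑ β, d β + 1) u v w d

/-! ### Effectivity -/

/-- Integer polynomials in `m` variables, as lists of terms (exponents, coefficient). -/
abbrev PolyCode (m : ℕ) : Type := List ((Fin m → ℕ) × ℤ)

/-- The polynomial with a given code. -/
def decodePoly {m : ℕ} (e : Fin m ≃ b.support) (l : PolyCode m) : MvPolynomial b.support ℤ :=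
  (l.map fun t => MvPolynomial.C t.2 * ∏ i, MvPolynomial.X (e i) ^ t.1 i).sum

/-- A family of rational functions is computable: once the finitely many simple roots and elements
of `W^P` are numbered, some recursive function takes `(u, v, w, d)` to the numerator and
the denominator of a fraction that is equal to `c u v w d`. -/
def IsEffective (c : Coeffs b J) : Prop :=
  ∀ (m k r : ℕ) (eΔ : Fin m ≃ b.support) (eD : Fin k ≃ DivRoot b J) (eW : Fin r ≃ MinRep b J),
    ∃ prog : Fin r × Fin r × Fin r × (Fin k → ℕ) → PolyCode m × PolyCode m,
      Computable prog ∧ ∀ (u v w : Fin r) (d : Fin k → ℕ),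
        decodePoly b eΔ (prog (u, v, w, d)).2 ≠ 0 ∧
        c (eW u) (eW v) (eW w) (d ∘ eD.symm) =
          algebraMap _ (RatFun b) (decodePoly b eΔ (prog (u, v, w, d)).1) /
            algebraMap _ (RatFun b) (decodePoly b eΔ (prog (u, v, w, d)).2)

end

end EQLR

/-! The word sums that define the Chevalley coefficients telescope:
$D(s_\beta,w)=\omega_\beta-w\omega_\beta$. Hence $F_{w,u}(\beta)$ is the linear form of
$u\omega_\beta-w\omega_\beta$ (`F_eq`). The vectors $w\omega_\beta$ with $\beta\notin\Delta_P$
determine the coset $wW_P$, so some $F_{w,u}(\beta)$ is nonzero when $u\ne w$. Along a reflection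
$w=us_\alpha$ that raises the codimension the difference is $h_\alpha(\omega_\beta)\,u\alpha$ with
$u\alpha$ a negative root. So all $F_{w,u}(\beta)$ with $u\prec w$ are nonnegative forms in the
$x_i$ (`Prec.isNonnegForm`).

Fix $d$ and suppose that the smaller multidegrees are known. Each use of (c) raises $c(u)$ or lowers
$c(w)$ in the terms of multidegree $d$, so it stops after boundedly many steps. If $u\not\prec w$ it
never meets a coefficient with $u=w$, and the value depends on smaller multidegrees only
(`offTerm_eq`). If $u\prec w$, unrolling (c) along the paths from $u$ to $w$ gives
$c_{u,w}^{w,d}=R(u,w;f)\,c_{w,w}^{w,d}+E'$ (`eq_pathSum_mul_add_pathTerm`). At $u=\overline w_0$ the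
left side is given by (a), so $c_{w,w}^{w,d}$ is found by division by $R$. All other coefficients
follow by descending induction on the polynomial degree (`fullTerm_eq`).

To have $R(\overline w_0,w;f)\ne0$, join $\overline w_0$ to $w$ by classical steps
(`exists_classicalStep`) and choose $\beta(v)$ so that some step out of $v$ towards $w$ has nonzero
weight (`exists_good_divRoot`). With all $x_i$ set to $1$, every path weight is nonnegative and one
is positive.

For effectivity, one round of the algorithm is an $R(\Lambda)$-linear combination of nontrivial
shifts of the multidegree and of $\delta_{d,0}$ (`fullTerm_mem`). The output therefore solves a
finite linear recursion in $d$ with constant coefficients. Multiplying by a power of a common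
denominator makes the recursion polynomial, and it is then run on lists of signed monomials by a
primitive recursive function. -/

namespace EQLR

noncomputable section

/-! ### Weyl group elements and positive roots -/

section Coxeter

variable {ι M N : Type*} [Fintype ι] [AddCommGroup M] [Module ℚ M] [AddCommGroup N] [Module ℚ N]
  {P : RootPairing ι ℚ M N} [P.IsRootSystem] [P.IsCrystallographic] [P.IsReduced]

/-- The action of a Weyl group element on the index set of the roots. -/
abbrev act (w : P.weylGroup) (α : ι) : ι := P.weylGroupToPerm w α

/-- The reflection of a root, as an element of the Weyl group. -/
abbrev refl (P : RootPairing ι ℚ M N) (α : ι) : P.weylGroup := RootPairing.weylGroup.ofIdx P α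

theorem root_act (w : P.weylGroup) (α : ι) : P.root (act w α) = w • P.root α :=
  (P.weylGroup_apply_root w α).symm

theorem act_mul (v w : P.weylGroup) (α : ι) : act (v * w) α = act v (act w α) := by
  simp [act, map_mul]

theorem act_one (α : ι) : act (1 : P.weylGroup) α = α := by
  simp [act]

theorem act_refl (α γ : ι) : act (refl P α) γ = P.reflectionPerm α γ := rfl

theorem refl_smul (α : ι) (x : M) : refl P α • x = P.reflection α x := rfl

theorem refl_mul_self (α : ι) : refl P α * refl P α = 1 := by
  apply Subtype.ext
  apply RootPairing.Equiv.weightHom_injective P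
  refine LinearEquiv.ext fun x => ?_
  change P.reflection α (P.reflection α x) = x
  simp

theorem refl_inv (α : ι) : (refl P α)⁻¹ = refl P α :=
  inv_eq_of_mul_eq_one_right (refl_mul_self α)

theorem refl_mul_cancel_left (α : ι) (w : P.weylGroup) : refl P α * (refl P α * w) = w := by
  rw [← mul_assoc, refl_mul_self, one_mul]

theorem refl_act (w : P.weylGroup) (α : ι) : refl P (act w α) = w * refl P α * w⁻¹ := by
  obtain ⟨w, hw⟩ := w
  induction hw using RootPairing.weylGroup.induction generalizing α with
  | mem i =>
    change refl P (P.reflectionPerm i α) = refl P i * refl P α * (refl P i)⁻¹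
    rw [refl_inv]
    exact ofIdx_reflectionPerm i α
  | one =>
    change refl P (act (1 : P.weylGroup) α) = (1 : P.weylGroup) * refl P α * (1 : P.weylGroup)⁻¹
    rw [act_one]; simp
  | mul x y hx hy h1 h2 =>
    have h3 : (⟨x * y, mul_mem hx hy⟩ : P.weylGroup) = ⟨x, hx⟩ * ⟨y, hy⟩ := rfl
    rw [h3, act_mul, h1, h2]
    group

theorem root_reflectionPerm_self' (α : ι) : P.root (P.reflectionPerm α α) = - P.root α := by
  rw [P.root_reflectionPerm]; simp

theorem act_refl_self (w : P.weylGroup) (α : ι) :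
    act w (P.reflectionPerm α α) = P.reflectionPerm (act w α) (act w α) := by
  apply P.root.injective
  rw [root_act, root_reflectionPerm_self', root_reflectionPerm_self', root_act, smul_neg]

theorem refl_reflectionPerm_self (α : ι) : refl P (P.reflectionPerm α α) = refl P α := by
  refine (ofIdx_reflectionPerm α α).trans ?_
  rw [refl_mul_self, one_mul]

variable (b : P.Base)

theorem isPos_neg_iff (α : ι) : b.IsPos (P.reflectionPerm α α) ↔ ¬ b.IsPos α :=
  RootPairing.Base.IsPos.neg_iff_not b α

theorem isPos_support (i : b.support) : b.IsPos (i : ι) :=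
  RootPairing.Base.isPos_of_mem_support i.2

theorem wordProd_nil : wordProd b [] = 1 := by simp [wordProd]

theorem wordProd_singleton (i : b.support) : wordProd b [i] = refl P i := by simp [wordProd]

theorem wordProd_cons (i : b.support) (l : List b.support) :
    wordProd b (i :: l) = refl P i * wordProd b l := by
  simp [wordProd]

theorem wordProd_append (l l' : List b.support) :
    wordProd b (l ++ l') = wordProd b l * wordProd b l' := by
  simp [wordProd]

theorem isPos_reflectionPerm (i : b.support) {α : ι} (hα : b.IsPos α) (h : α ≠ i) :
    b.IsPos (P.reflectionPerm i α) :=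
  hα.reflectionPerm i.2 h

theorem length_wordProd_le (l : List b.support) : length b (wordProd b l) ≤ l.length :=
  Nat.sInf_le ⟨l, rfl, rfl⟩

/-- The strong exchange property. -/
theorem exists_word_mul_refl {α : ι} (hα : b.IsPos α) (l : List b.support)
    (h : ¬ b.IsPos (act (wordProd b l) α)) :
    ∃ l' : List b.support, wordProd b l' = wordProd b l * refl P α ∧ l'.length + 1 = l.length := by
  induction l with
  | nil => exact absurd (by rwa [wordProd_nil, act_one]) h
  | cons i l ih =>
    rw [wordProd_cons, act_mul, act_refl] at h
    by_cases h' : b.IsPos (act (wordProd b l) α)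
    -- A simple reflection makes only its own root negative. So $s_i$ is the conjugate of $s_\alpha$
    -- by the rest of the word, and deleting the letter $i$ amounts to right multiplication by
    -- $s_\alpha$.
    · have h1 : act (wordProd b l) α = i := by
        by_contra hne
        exact h (isPos_reflectionPerm b i h' hne)
      refine ⟨l, ?_, rfl⟩
      have h2 := refl_act (wordProd b l) α
      rw [h1] at h2
      rw [wordProd_cons, h2]
      simp only [mul_assoc, inv_mul_cancel_left]
      rw [refl_mul_self, mul_one]
    · obtain ⟨l', h1, h2⟩ := ih h'
      exact ⟨i :: l', by rw [wordProd_cons, h1, wordProd_cons, mul_assoc], by simp [h2]⟩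

theorem length_mul_refl_lt {w : P.weylGroup} {α : ι} (hα : b.IsPos α) (h : ¬ b.IsPos (act w α)) :
    length b (w * refl P α) < length b w := by
  obtain ⟨l, hl, hlen⟩ := exists_reducedWord b w
  rw [← hl] at h
  obtain ⟨l', h1, h2⟩ := exists_word_mul_refl b hα l h
  have h3 := length_wordProd_le b l'
  rw [h1, hl] at h3
  omega

theorem length_lt_mul_refl {w : P.weylGroup} {α : ι} (hα : b.IsPos α) (h : b.IsPos (act w α)) :
    length b w < length b (w * refl P α) := by
  have h1 : ¬ b.IsPos (act (w * refl P α) α) := by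
    rw [act_mul, act_refl, act_refl_self, isPos_neg_iff]
    exact not_not_intro h
  have := length_mul_refl_lt b hα h1
  rwa [mul_assoc, refl_mul_self, mul_one] at this

theorem length_one : length b (1 : P.weylGroup) = 0 := by
  have := length_wordProd_le b []
  simpa [wordProd] using this

theorem length_eq_zero {w : P.weylGroup} (h : length b w = 0) : w = 1 := by
  obtain ⟨l, hl, hlen⟩ := exists_reducedWord b w
  rw [h, List.length_eq_zero_iff] at hlen
  rw [← hl, hlen]; simp [wordProd]

theorem length_refl_mul_le (w : P.weylGroup) (i : b.support) :
    length b (refl P i * w) ≤ length b w + 1 := by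
  obtain ⟨l, hl, hlen⟩ := exists_reducedWord b w
  have := length_wordProd_le b (i :: l)
  rw [wordProd_cons, hl] at this
  simpa [hlen] using this

/-- The last letter of a reduced word works: were its image positive, dropping it would increase the
length. This is the test for $w=1$ used throughout. -/
theorem exists_simple_act_not_isPos {w : P.weylGroup} (h : w ≠ 1) :
    ∃ i : b.support, ¬ b.IsPos (act w i) := by
  obtain ⟨l, hl, hlen⟩ := exists_reducedWord b w
  rcases List.eq_nil_or_concat l with rfl | ⟨l', i, rfl⟩
  · exact absurd (by rw [← hl]; simp [wordProd]) h
  · refine ⟨i, fun hp => ?_⟩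
    have h1 := length_lt_mul_refl b (isPos_support b i) hp
    have h2 : w * refl P i = wordProd b l' := by
      rw [← hl, List.concat_eq_append, wordProd_append, wordProd_singleton, mul_assoc, refl_mul_self, mul_one]
    have h3 := length_wordProd_le b l'
    rw [← h2] at h3
    simp at hlen
    omega

theorem exists_length_refl_mul {w : P.weylGroup} (h : w ≠ 1) :
    ∃ i : b.support, length b (refl P i * w) + 1 = length b w := by
  obtain ⟨l, hl, hlen⟩ := exists_reducedWord b w
  rcases l with _ | ⟨i, l⟩
  · exact absurd (by rw [← hl]; simp [wordProd]) h
  · refine ⟨i, ?_⟩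
    have h2 : refl P i * w = wordProd b l := by
      rw [← hl, wordProd_cons, refl_mul_cancel_left]
    have h3 := length_wordProd_le b l
    have h4 := length_refl_mul_le b (refl P i * w) i
    rw [refl_mul_cancel_left] at h4
    rw [← h2] at h3
    simp at hlen
    omega

/-! ### Nonnegative combinations of simple roots -/

/-- Nonnegative integral combinations of simple roots. -/
def posCone : AddSubmonoid M := AddSubmonoid.closure (Set.range fun i : b.support => P.root i)

theorem root_mem_posCone {α : ι} (hα : b.IsPos α) : P.root α ∈ posCone b := by
  obtain ⟨f, hf, h | h⟩ := b.exists_root_eq_sum_nat_or_neg α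
  · rw [h]
    exact sum_mem fun j hj => AddSubmonoid.nsmul_mem _ (AddSubmonoid.subset_closure (Set.mem_range_self (⟨j, hj⟩ : b.support))) _
  · exfalso
    have h1 : P.root α = ∑ j ∈ b.support, (-(f j : ℤ)) • P.root j := by
      rw [h]; simp
    rw [RootPairing.Base.isPos_iff, b.height_eq_sum h1] at hα
    have h2 : ∑ j ∈ b.support, (-(f j : ℤ)) ≤ 0 := Finset.sum_nonpos fun j _ => by omega
    omega

theorem repr_nonneg_of_mem_posCone {x : M} (hx : x ∈ posCone b) (i : b.support) :
    0 ≤ b.toWeightBasis.repr x i := by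
  induction hx using AddSubmonoid.closure_induction with
  | mem x hx =>
    obtain ⟨j, rfl⟩ := hx
    simp only [RootPairing.Base.toWeightBasis_repr_root, Finsupp.single_apply]
    split_ifs <;> norm_num
  | zero => simp
  | add x y _ _ h1 h2 => simp only [map_add, Finsupp.add_apply]; exact add_nonneg h1 h2

theorem eq_zero_of_mem_posCone_neg {x : M} (hx : x ∈ posCone b) (hx' : -x ∈ posCone b) : x = 0 := by
  apply b.toWeightBasis.repr.injective
  ext i
  have h1 := repr_nonneg_of_mem_posCone b hx i
  have h2 := repr_nonneg_of_mem_posCone b hx' i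
  simp only [map_neg, Finsupp.neg_apply] at h2
  simp only [map_zero, Finsupp.zero_apply]
  linarith

theorem neg_root_mem_posCone {α : ι} (hα : ¬ b.IsPos α) : - P.root α ∈ posCone b := by
  rw [← root_reflectionPerm_self']
  exact root_mem_posCone b ((isPos_neg_iff b α).mpr hα)

/-- A Weyl group element that maps all simple roots in `J` to positive roots maps all positive
roots in the span of `J` to positive roots. -/
theorem isPos_act_of_mem_span {J : Set b.support} {w : P.weylGroup}
    (hw : ∀ j ∈ J, b.IsPos (act w (j : ι))) {α : ι} (hα : b.IsPos α)
    (hs : P.root α ∈ Submodule.span ℚ ((fun i : b.support => P.root i) '' J)) :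
    b.IsPos (act w α) := by
  by_contra hn
  have h0 := neg_root_mem_posCone b hn
  have hrep : ∀ i ∉ J, b.toWeightBasis.repr (P.root α) i = 0 := by
    intro i hi
    refine Submodule.span_induction (p := fun x _ => b.toWeightBasis.repr x i = 0) ?_ ?_ ?_ ?_ hs
    · rintro _ ⟨j, hj, rfl⟩
      simp only [RootPairing.Base.toWeightBasis_repr_root]
      rw [Finsupp.single_apply, if_neg]
      rintro rfl; exact hi hj
    · simp
    · intro x y _ _ hx hy; simp [hx, hy]
    · intro a x _ hx; simp [hx]
  -- Expand $w\alpha$ in the images of the simple roots: those in $J$ are positive with nonnegative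
  -- coefficients, and the others have coefficient zero.
  have h1 : ∀ k, 0 ≤ b.toWeightBasis.repr (P.root (act w α)) k := by
    intro k
    have h2 : P.root (act w α) =
        ∑ i, b.toWeightBasis.repr (P.root α) i • P.root (act w (i : ι)) := by
      rw [root_act]
      conv_lhs => rw [← b.toWeightBasis.sum_repr (P.root α)]
      rw [Finset.smul_sum]
      refine Finset.sum_congr rfl fun i _ => ?_
      rw [root_act, RootPairing.Base.toWeightBasis_apply]
      exact smul_comm (w : P.Aut) (b.toWeightBasis.repr (P.root α) i) (P.root i)
    rw [h2, map_sum, Finsupp.finsetSum_apply]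
    refine Finset.sum_nonneg fun i _ => ?_
    rw [map_smul, Finsupp.smul_apply, smul_eq_mul]
    by_cases hi : i ∈ J
    · exact mul_nonneg (repr_nonneg_of_mem_posCone b (root_mem_posCone b hα) i)
        (repr_nonneg_of_mem_posCone b (root_mem_posCone b (hw i hi)) k)
    · rw [hrep i hi, zero_mul]
  have h3 : P.root (act w α) = 0 := by
    apply b.toWeightBasis.repr.injective
    ext k
    have h2 := repr_nonneg_of_mem_posCone b h0 k
    have h4 := h1 k
    simp only [map_neg, Finsupp.neg_apply] at h2
    simp only [map_zero, Finsupp.zero_apply]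
    linarith
  exact P.ne_zero _ h3

/-! ### The longest element -/

theorem not_isPos_longest_simple (i : b.support) : ¬ b.IsPos (act (longest b) i) := by
  intro h
  have h1 := length_lt_mul_refl b (isPos_support b i) h
  have h2 := (exists_longest b).choose_spec (longest b * refl P i)
  change _ ≤ length b (longest b) at h2
  omega

theorem neg_longest_smul_mem_posCone {x : M} (hx : x ∈ posCone b) :
    -(longest b • x) ∈ posCone b := by
  induction hx using AddSubmonoid.closure_induction with
  | mem x hx =>
    obtain ⟨j, rfl⟩ := hx
    have := neg_root_mem_posCone b (not_isPos_longest_simple b j)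
    rwa [root_act] at this
  | zero => simp
  | add x y _ _ h1 h2 => rw [smul_add, neg_add]; exact add_mem h1 h2

theorem isPos_longest_act_iff (α : ι) : b.IsPos (act (longest b) α) ↔ ¬ b.IsPos α := by
  have key : ∀ γ, b.IsPos γ → ¬ b.IsPos (act (longest b) γ) := by
    intro γ hγ h
    have h1 := neg_longest_smul_mem_posCone b (root_mem_posCone b hγ)
    rw [← root_act] at h1
    exact P.ne_zero _ (eq_zero_of_mem_posCone_neg b (root_mem_posCone b h) h1)
  constructor
  · exact fun h h' => key α h' h
  · intro h
    have h1 := key _ ((isPos_neg_iff b α).mpr h)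
    rw [act_refl_self, isPos_neg_iff] at h1
    exact not_not.mp h1

/-- $w_0$ exchanges positive and negative roots, so $w_0^2$ keeps every simple root positive. -/
theorem longest_mul_self : longest b * longest b = 1 := by
  by_contra h
  obtain ⟨i, hi⟩ := exists_simple_act_not_isPos b h
  rw [act_mul, isPos_longest_act_iff, isPos_longest_act_iff] at hi
  exact hi (not_not_intro (isPos_support b i))

theorem longest_mul_cancel_left (w : P.weylGroup) : longest b * (longest b * w) = w := by
  rw [← mul_assoc, longest_mul_self, one_mul]

/-! ### Fundamental weights -/

theorem fundWeight_coroot (β j : b.support) :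
    P.toLinearMap (fundWeight b β) (P.coroot j) = if j = β then 1 else 0 := by
  rw [fundWeight_apply, b.toCoweightBasis_repr_coroot, Finsupp.single_apply]

theorem refl_smul_fundWeight (α : ι) (β : b.support) :
    refl P α • fundWeight b β =
      fundWeight b β - P.toLinearMap (fundWeight b β) (P.coroot α) • P.root α := by
  rw [refl_smul, P.reflection_apply]
  rfl

/-- Telescoping: $\omega_\beta-s_i\omega_\beta$ is $\beta$ if $\beta_i=\beta$ and $0$ otherwise. In
particular the sum depends only on the product of the word. -/
theorem wordD_eq (β : b.support) (l : List b.support) :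
    wordD b β l = fundWeight b β - wordProd b l • fundWeight b β := by
  induction l with
  | nil => simp [wordD, wordProd]
  | cons i l ih =>
    rw [wordD, ih, wordProd_cons, mul_smul, ← refl_smul, smul_sub, refl_smul_fundWeight,
      fundWeight_coroot]
    split_ifs with h
    · subst h; simp; abel
    · simp

theorem chevD_eq (β : b.support) (w : P.weylGroup) :
    chevD b β w = fundWeight b β - w • fundWeight b β := by
  rw [chevD, wordD_eq, reducedWord, (exists_reducedWord b w).choose_spec.1]

end Coxeter

/-! ### Cosets of the parabolic subgroup and the sign of the linear forms $F_{w,u}(\beta)$. -/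

section Parabolic

variable {ι M N : Type*} [Fintype ι] [AddCommGroup M] [Module ℚ M] [AddCommGroup N] [Module ℚ N]
  {P : RootPairing ι ℚ M N} [P.IsRootSystem] [P.IsCrystallographic] [P.IsReduced]
  (b : P.Base)

/-! ### Pairings with fundamental weights -/

/-- Compare the coefficients of $w\alpha$ in $s_{w\alpha}(wx)=w(s_\alpha x)$. -/
theorem pairing_act (w : P.weylGroup) (x : M) (α : ι) :
    P.toLinearMap (w • x) (P.coroot (act w α)) = P.toLinearMap x (P.coroot α) := by
  have h1 : refl P (act w α) • (w • x) = w • (refl P α • x) := by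
    rw [refl_act, ← mul_smul, ← mul_smul]
    simp
  rw [refl_smul, refl_smul, P.reflection_apply, P.reflection_apply, smul_sub, sub_right_inj,
    root_act] at h1
  have h2 : w • (P.toLinearMap x (P.coroot α)) • P.root α =
      P.toLinearMap x (P.coroot α) • w • P.root α := smul_comm (w : P.Aut) _ _
  change P.toLinearMap (w • x) (P.coroot (act w α)) • w • P.root α =
    w • (P.toLinearMap x (P.coroot α)) • P.root α at h1
  rw [h2, ← root_act] at h1
  exact smul_left_injective ℚ (P.ne_zero _) h1

theorem pairing_fundWeight_nonneg {α : ι} (hα : b.IsPos α) (β : b.support) :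
    0 ≤ P.toLinearMap (fundWeight b β) (P.coroot α) := by
  rw [← cast_coef b hα]
  exact Nat.cast_nonneg _

theorem coroot_reflectionPerm_self' (α : ι) :
    P.coroot (P.reflectionPerm α α) = - P.coroot α := by
  rw [P.coroot_reflectionPerm]; simp

theorem pairing_fundWeight_nonpos {α : ι} (hα : ¬ b.IsPos α) (β : b.support) :
    P.toLinearMap (fundWeight b β) (P.coroot α) ≤ 0 := by
  have := pairing_fundWeight_nonneg b ((isPos_neg_iff b α).mpr hα) β
  rw [coroot_reflectionPerm_self', map_neg] at this
  linarith

/-- By invariance $\omega_i=w\omega_i$ pairs to $1$ with the coroot of $w\alpha_i$, whereas it pairs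
nonpositively with the coroots of negative roots. -/
theorem isPos_act_of_smul_fundWeight_eq {w : P.weylGroup} {i : b.support}
    (h : w • fundWeight b i = fundWeight b i) : b.IsPos (act w i) := by
  by_contra hn
  have h1 := pairing_fundWeight_nonpos b hn i
  have h2 := pairing_act w (fundWeight b i) i
  rw [h, fundWeight_coroot, if_pos rfl] at h2
  linarith

variable (J : Set b.support)

/-- The span of the simple roots in `J`. -/
abbrev parabolicSpan : Submodule ℚ M := Submodule.span ℚ ((fun i : b.support => P.root i) '' J)

/-- The coroot is not linear in the root, but it is a multiple of the polarization of the root,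
which is linear. Vanishing is thus checked on the simple roots in $J$. -/
theorem pairing_fundWeight_eq_zero {α : ι} (hs : P.root α ∈ parabolicSpan b J) {β : b.support}
    (hβ : β ∉ J) : P.toLinearMap (fundWeight b β) (P.coroot α) = 0 := by
  have key : ∀ γ, P.RootForm (P.root γ) (P.root γ) *
      P.toLinearMap (fundWeight b β) (P.coroot γ) =
      2 * P.toLinearMap (fundWeight b β) (P.Polarization (P.root γ)) := by
    intro γ
    have := congrArg (P.toLinearMap (fundWeight b β)) (P.rootForm_self_smul_coroot γ)
    rw [map_smul, map_nsmul] at this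
    simpa using this
  have h0 : P.toLinearMap (fundWeight b β) (P.Polarization (P.root α)) = 0 := by
    refine Submodule.span_induction
      (p := fun x _ => P.toLinearMap (fundWeight b β) (P.Polarization x) = 0) ?_ ?_ ?_ ?_ hs
    · rintro _ ⟨j, hj, rfl⟩
      have h1 := key j
      rw [fundWeight_coroot, if_neg (by rintro rfl; exact hβ hj), mul_zero] at h1
      simpa using h1.symm
    · simp
    · intro x y _ _ hx hy; simp only [map_add, hx, hy, add_zero]
    · intro a x _ hx; simp only [map_smul, hx, smul_zero]
  have h1 := key α
  rw [h0, mul_zero] at h1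
  exact (mul_eq_zero.mp h1).resolve_left (RootPairing.IsAnisotropic.rootForm_root_ne_zero α)

/-! ### The parabolic subgroup -/

theorem parabolic_smul_fundWeight {p : P.weylGroup} (hp : p ∈ parabolicWeyl b J) {β : b.support}
    (hβ : β ∉ J) : p • fundWeight b β = fundWeight b β := by
  induction hp using Subgroup.closure_induction with
  | mem x hx =>
    obtain ⟨j, hj, rfl⟩ := hx
    change refl P j • _ = _
    rw [refl_smul_fundWeight, fundWeight_coroot, if_neg (by rintro rfl; exact hβ hj)]
    simp
  | one => exact one_smul _ _
  | mul x y _ _ h1 h2 => rw [mul_smul, h2, h1]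
  | inv x _ h1 => rw [inv_smul_eq_iff, h1]

theorem parabolic_smul_sub_mem {p : P.weylGroup} (hp : p ∈ parabolicWeyl b J) (m : M) :
    p • m - m ∈ parabolicSpan b J := by
  induction hp using Subgroup.closure_induction generalizing m with
  | mem x hx =>
    obtain ⟨j, hj, rfl⟩ := hx
    change refl P j • _ - _ ∈ _
    rw [refl_smul, P.reflection_apply, sub_sub_cancel_left]
    exact neg_mem (Submodule.smul_mem _ _ (Submodule.subset_span ⟨j, hj, rfl⟩))
  | one => rw [one_smul, sub_self]; exact zero_mem _
  | mul x y _ _ h1 h2 =>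
    have := add_mem (h1 (y • m)) (h2 m)
    rwa [sub_add_sub_cancel, ← mul_smul] at this
  | inv x _ h1 =>
    have := neg_mem (h1 (x⁻¹ • m))
    rwa [smul_inv_smul, neg_sub] at this

theorem repr_eq_zero_of_mem_parabolicSpan {x : M} (hx : x ∈ parabolicSpan b J) {i : b.support}
    (hi : i ∉ J) : b.toWeightBasis.repr x i = 0 := by
  refine Submodule.span_induction (p := fun x _ => b.toWeightBasis.repr x i = 0) ?_ ?_ ?_ ?_ hx
  · rintro _ ⟨j, hj, rfl⟩
    simp only [RootPairing.Base.toWeightBasis_repr_root]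
    rw [Finsupp.single_apply, if_neg]
    rintro rfl; exact hi hj
  · simp
  · intro x y _ _ hx hy; simp [hx, hy]
  · intro a x _ hx; simp [hx]

theorem mem_parabolicSpan_of_repr {x : M} (h : ∀ i ∉ J, b.toWeightBasis.repr x i = 0) :
    x ∈ parabolicSpan b J := by
  rw [← b.toWeightBasis.sum_repr x]
  refine sum_mem fun i _ => ?_
  by_cases hi : i ∈ J
  · rw [RootPairing.Base.toWeightBasis_apply]
    exact Submodule.smul_mem _ _ (Submodule.subset_span ⟨i, hi, rfl⟩)
  · rw [h i hi, zero_smul]; exact zero_mem _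

/-- Elements of $W_P$ change only the coordinates in $J$, and a root outside the span of $J$ has a
nonzero coordinate elsewhere, which keeps its sign. -/
theorem isPos_parabolic_act {p : P.weylGroup} (hp : p ∈ parabolicWeyl b J) {α : ι}
    (hα : IsOuter b J α) : b.IsPos (act p α) := by
  by_contra hn
  refine hα.2 (mem_parabolicSpan_of_repr b J fun i hi => ?_)
  have h1 := repr_eq_zero_of_mem_parabolicSpan b J (parabolic_smul_sub_mem b J hp (P.root α)) hi
  have h2 := repr_nonneg_of_mem_posCone b (root_mem_posCone b hα.1) i
  have h3 := repr_nonneg_of_mem_posCone b (neg_root_mem_posCone b hn) i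
  rw [← root_act] at h1
  simp only [map_sub, map_neg, Finsupp.neg_apply, Finsupp.sub_apply] at h1 h3
  linarith

/-! ### Minimal length representatives -/

theorem MinRep.isPos_act {J : Set b.support} (u : MinRep b J) {j : b.support} (hj : j ∈ J) :
    b.IsPos (act (u : P.weylGroup) j) := by
  by_contra hn
  have h1 := length_mul_refl_lt b (isPos_support b j) hn
  have h2 := u.2 (refl P j) (Subgroup.subset_closure ⟨j, hj, rfl⟩)
  omega

/-- If $x=u^{-1}w\ne1$, it makes some $\alpha_i$ negative. Since $x$ fixes $\omega_k$ for $k\notin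
J$, this $i$ is in $J$. Then $-x\alpha_i$ is a positive root in the span of $J$, so $u$ keeps it
positive, although its image is $-w\alpha_i$. -/
theorem eq_of_inv_mul_mem {u w : P.weylGroup} (hu : ∀ j ∈ J, b.IsPos (act u (j : ι)))
    (hw : ∀ j ∈ J, b.IsPos (act w (j : ι))) (h : u⁻¹ * w ∈ parabolicWeyl b J) : u = w := by
  by_contra hne
  obtain ⟨i, hi⟩ := exists_simple_act_not_isPos b (w := u⁻¹ * w)
    (fun h1 => hne (inv_mul_eq_one.mp h1))
  have hiJ : i ∈ J := by
    by_contra hiJ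
    exact hi (isPos_act_of_smul_fundWeight_eq b (parabolic_smul_fundWeight b J h hiJ))
  have hs : P.root (P.reflectionPerm (act (u⁻¹ * w) i) (act (u⁻¹ * w) i)) ∈ parabolicSpan b J := by
    rw [root_reflectionPerm_self', root_act]
    refine neg_mem ?_
    have := add_mem (parabolic_smul_sub_mem b J h (P.root i))
      (Submodule.subset_span (s := (fun i : b.support => P.root i) '' J) ⟨i, hiJ, rfl⟩)
    rwa [sub_add_cancel] at this
  have h1 := isPos_act_of_mem_span b hu ((isPos_neg_iff b _).mpr hi) hs
  rw [act_refl_self, isPos_neg_iff, ← act_mul, mul_inv_cancel_left] at h1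
  exact h1 (hw i hiJ)

variable {J}

theorem MinRep.eq_of_mem {u w : MinRep b J}
    (h : (u : P.weylGroup)⁻¹ * w ∈ parabolicWeyl b J) : u = w :=
  Subtype.ext (eq_of_inv_mul_mem b J (fun _ hj => u.isPos_act b hj)
    (fun _ hj => w.isPos_act b hj) h)

variable (J)

theorem minRep_spec (w : P.weylGroup) :
    w⁻¹ * (minRep b J w : P.weylGroup) ∈ parabolicWeyl b J :=
  (exists_minRep b J w).choose_spec

theorem inv_mul_mem_symm {u w : P.weylGroup} (h : u⁻¹ * w ∈ parabolicWeyl b J) :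
    w⁻¹ * u ∈ parabolicWeyl b J := by
  simpa using inv_mem h

theorem inv_mul_mem_trans {u v w : P.weylGroup} (h : u⁻¹ * v ∈ parabolicWeyl b J)
    (h' : v⁻¹ * w ∈ parabolicWeyl b J) : u⁻¹ * w ∈ parabolicWeyl b J := by
  simpa [mul_assoc] using mul_mem h h'

theorem inv_mul_mem_left (v : P.weylGroup) {u w : P.weylGroup}
    (h : u⁻¹ * w ∈ parabolicWeyl b J) : (v * u)⁻¹ * (v * w) ∈ parabolicWeyl b J := by
  simpa [mul_assoc] using h

variable {J}

theorem minRep_eq {w : P.weylGroup} {u : MinRep b J}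
    (h : w⁻¹ * (u : P.weylGroup) ∈ parabolicWeyl b J) : minRep b J w = u :=
  MinRep.eq_of_mem b (inv_mul_mem_trans b J (inv_mul_mem_symm b J (minRep_spec b J w)) h)

variable (J)

theorem isMinRep_of_isPos {w : P.weylGroup} (hw : ∀ j ∈ J, b.IsPos (act w (j : ι))) :
    ∀ v ∈ parabolicWeyl b J, length b w ≤ length b (w * v) := by
  have h : w = minRep b J w := eq_of_inv_mul_mem b J hw
    (fun _ hj => (minRep b J w).isPos_act b hj) (minRep_spec b J w)
  rw [h]
  exact (minRep b J w).2

variable {J}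

theorem dual_spec (w : MinRep b J) :
    (longest b * w)⁻¹ * (dual b J w : P.weylGroup) ∈ parabolicWeyl b J :=
  minRep_spec b J _

theorem dual_dual (w : MinRep b J) : dual b J (dual b J w) = w := by
  refine minRep_eq b ?_
  have := inv_mul_mem_left b J (longest b) (inv_mul_mem_symm b J (dual_spec b w))
  rwa [longest_mul_cancel_left] at this

theorem codim_le_of_mem {w : MinRep b J} {v : P.weylGroup}
    (h : (longest b * w)⁻¹ * v ∈ parabolicWeyl b J) : codim b J w ≤ length b v := by
  have h1 := (dual b J w).2 _ (inv_mul_mem_trans b J (inv_mul_mem_symm b J (dual_spec b w)) h)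
  rwa [mul_inv_cancel_left] at h1

theorem eq_unitRep_of_codim_eq_zero {w : MinRep b J} (h : codim b J w = 0) :
    w = unitRep b J := by
  have h1 : ((dual b J w : MinRep b J) : P.weylGroup) = 1 := length_eq_zero b h
  rw [← dual_dual b w, dual, h1, mul_one]
  rfl

/-- Different cosets are separated by the orbits of the fundamental weights. -/
theorem exists_smul_fundWeight_ne {u w : MinRep b J} (h : u ≠ w) :
    ∃ β : DivRoot b J, (u : P.weylGroup) • fundWeight b β ≠ (w : P.weylGroup) • fundWeight b β := by
  by_contra! hc
  apply h
  set x := (u : P.weylGroup)⁻¹ * w with hx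
  have hy := minRep_spec b J x
  set y := minRep b J x
  -- $y$ is $u^{-1}w$ times an element of $W_P$, and both factors fix these weights. Being a minimal
  -- representative, $y$ also keeps the roots in $J$ positive, so it makes no simple root negative.
  have hfix : ∀ β : DivRoot b J, (y : P.weylGroup) • fundWeight b β = fundWeight b β := by
    intro β
    have h1 : (y : P.weylGroup) = x * (x⁻¹ * y) := by simp
    rw [h1, mul_smul, parabolic_smul_fundWeight b J hy β.2, hx, mul_smul, ← hc β, inv_smul_smul]
  have hy1 : (y : P.weylGroup) = 1 := by
    by_contra hne
    obtain ⟨i, hi⟩ := exists_simple_act_not_isPos b hne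
    by_cases hiJ : i ∈ J
    · exact hi (y.isPos_act b hiJ)
    · exact hi (isPos_act_of_smul_fundWeight_eq b (hfix ⟨i, hiJ⟩))
  rw [hy1, mul_one] at hy
  have := inv_mem hy
  rw [inv_inv] at this
  exact MinRep.eq_of_mem b this

theorem smul_sub_smul_fundWeight {u w : MinRep b J} {α : ι}
    (h : (w : P.weylGroup) = u * refl P α) (β : b.support) :
    (u : P.weylGroup) • fundWeight b β - (w : P.weylGroup) • fundWeight b β =
      P.toLinearMap (fundWeight b β) (P.coroot α) • P.root (act (u : P.weylGroup) α) := by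
  rw [h, mul_smul, refl_smul_fundWeight, smul_sub, sub_sub_cancel, root_act]
  exact smul_comm ((u : P.weylGroup) : P.Aut) _ _

theorem isOuter_of_eq_mul_refl {u w : MinRep b J} (hne : u ≠ w) {α : ι} (hα : b.IsPos α)
    (h : (w : P.weylGroup) = u * refl P α) : IsOuter b J α := by
  refine ⟨hα, fun hs => ?_⟩
  obtain ⟨β, hβ⟩ := exists_smul_fundWeight_ne b hne
  apply hβ
  rw [← sub_eq_zero, smul_sub_smul_fundWeight b h, pairing_fundWeight_eq_zero b J hs β.2, zero_smul]

theorem exists_pos_refl_eq (α : ι) : ∃ γ, b.IsPos γ ∧ refl P γ = refl P α := by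
  by_cases h : b.IsPos α
  · exact ⟨α, h, rfl⟩
  · exact ⟨_, (isPos_neg_iff b α).mpr h, refl_reflectionPerm_self α⟩

/-- Every representative other than `w̄₀` is the end of a classical step. -/
theorem exists_classicalStep {w : MinRep b J} (h : codim b J w ≠ 0) :
    ∃ α w', ClassicalStep b J α w' w := by
  have hy1 : ((dual b J w : MinRep b J) : P.weylGroup) ≠ 1 := by
    intro h1
    rw [codim, h1, length_one] at h
    exact h rfl
  obtain ⟨i, hi⟩ := exists_length_refl_mul b hy1
  have hw := dual_spec b w
  have hcw : codim b J w = length b (dual b J w : P.weylGroup) := rfl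
  set y := dual b J w
  -- Otherwise $y\alpha_p=\alpha_i$ for some $p\in J$, so that $s_iy=ys_p$ would be longer than $y$.
  have hy' : ∀ j ∈ J, b.IsPos (act (refl P i * (y : P.weylGroup)) (j : ι)) := by
    intro p hp
    rw [act_mul, act_refl]
    refine isPos_reflectionPerm b i (y.isPos_act b hp) fun heq => ?_
    have h1 := refl_act (y : P.weylGroup) p
    rw [heq] at h1
    have h2 := length_lt_mul_refl b (isPos_support b p) (y.isPos_act b hp)
    rw [h1] at hi
    simp only [inv_mul_cancel_right] at hi
    omega
  set y' : MinRep b J := ⟨refl P i * (y : P.weylGroup), isMinRep_of_isPos b J hy'⟩ with hy'_def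
  have hne : y' ≠ y := by
    intro heq
    have h1 : length b (y' : P.weylGroup) = length b (y : P.weylGroup) := by rw [heq]
    change length b (refl P i * (y : P.weylGroup)) = _ at h1
    omega
  -- The element whose dual should be $s_iy$. It is itself a minimal representative: if it made
  -- $\alpha_p$, $p\in J$, negative, then $-w_0w\alpha_p=\alpha_i$, and $s_iy$ and $y$ would lie in
  -- the same coset.
  set x : P.weylGroup := longest b * refl P i * longest b * w with hx_def
  have hx : ∀ j ∈ J, b.IsPos (act x (j : ι)) := by
    intro p hp
    by_contra hn
    rw [← isPos_longest_act_iff, ← act_mul, hx_def, mul_assoc, mul_assoc, longest_mul_cancel_left,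
      act_mul, act_refl] at hn
    have hneg : ¬ b.IsPos (act (longest b * (w : P.weylGroup)) p) := by
      rw [act_mul, isPos_longest_act_iff]
      exact not_not_intro (w.isPos_act b hp)
    set γ := act (longest b * (w : P.weylGroup)) p with hγ
    have hδ : P.reflectionPerm γ γ = i := by
      by_contra hne
      have h1 := isPos_reflectionPerm b i ((isPos_neg_iff b γ).mpr hneg) hne
      rw [← act_refl (P := P) (i : ι), act_refl_self, isPos_neg_iff] at h1
      exact h1 hn
    have h1 : refl P i = longest b * w * refl P p * (longest b * w)⁻¹ := by
      rw [← refl_act, ← hγ, ← hδ, refl_reflectionPerm_self]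
    apply hne
    refine MinRep.eq_of_mem b (inv_mul_mem_trans b J ?_ hw)
    have h2 : ((y' : P.weylGroup)⁻¹ * (longest b * w))⁻¹ =
        refl P p * ((longest b * w)⁻¹ * (y : P.weylGroup)) := by
      change ((refl P i * (y : P.weylGroup))⁻¹ * (longest b * w))⁻¹ = _
      rw [h1]
      group
    rw [← inv_mem_iff, h2]
    exact mul_mem (Subgroup.subset_closure ⟨p, hp, rfl⟩) hw
  set w' : MinRep b J := ⟨x, isMinRep_of_isPos b J hx⟩ with hw'_def
  have hd : dual b J w' = y' := by
    refine minRep_eq b ?_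
    have h1 := inv_mul_mem_left b J (refl P i) hw
    have h2 : longest b * (w' : P.weylGroup) = refl P i * (longest b * w) := by
      change longest b * x = _
      rw [hx_def, mul_assoc, mul_assoc, longest_mul_cancel_left]
    rw [h2]
    exact h1
  have hc : codim b J w = codim b J w' + 1 := by
    have : codim b J w' = length b (y' : P.weylGroup) := by rw [codim, hd]
    rw [this, hcw, ← hi]
  obtain ⟨α, hα, hrefl⟩ := exists_pos_refl_eq b (act ((w : P.weylGroup)⁻¹ * longest b) (i : ι))
  have heq : (w : P.weylGroup) = w' * refl P α := by
    have hl : (longest b)⁻¹ = longest b := inv_eq_of_mul_eq_one_right (longest_mul_self b)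
    rw [hrefl, refl_act]
    change _ = x * _
    rw [hx_def, mul_inv_rev, hl, inv_inv]
    simp only [mul_assoc, mul_inv_cancel_left]
    rw [longest_mul_cancel_left, refl_mul_cancel_left, longest_mul_cancel_left]
  have hne' : w' ≠ w := by
    intro h1
    rw [h1] at hc
    omega
  exact ⟨α, w', isOuter_of_eq_mul_refl b hne' hα heq, heq, hc⟩

/-- A reflection that raises the codimension lowers the orbit of a dominant weight in the
dominance order. -/
theorem not_isPos_act_of_codim_lt {u w : MinRep b J} {α : ι} (hα : IsOuter b J α)
    (h : (w : P.weylGroup) = u * refl P α) (hc : codim b J u < codim b J w) :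
    ¬ b.IsPos (act (u : P.weylGroup) α) := by
  intro hp
  -- The dual is $w_0uq$ with $q\in W_P$. If $u\alpha$ were positive, the dual would make the
  -- positive root $q^{-1}\alpha$ negative. Reflecting in that root shortens the dual and lands in
  -- $w_0wW_P$, contradicting the codimensions.
  set q := (longest b * u)⁻¹ * (dual b J u : P.weylGroup) with hq
  have hqm : q ∈ parabolicWeyl b J := dual_spec b u
  have hdu : (dual b J u : P.weylGroup) = longest b * u * q := by rw [hq]; group
  have hpos := isPos_parabolic_act b J (inv_mem hqm) hα
  have hneg : ¬ b.IsPos (act (dual b J u : P.weylGroup) (act q⁻¹ α)) := by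
    rw [← act_mul, hdu, mul_inv_cancel_right, act_mul, isPos_longest_act_iff]
    exact not_not_intro hp
  have h1 := length_mul_refl_lt b hpos hneg
  have h2 : codim b J w ≤ length b ((dual b J u : P.weylGroup) * refl P (act q⁻¹ α)) := by
    refine codim_le_of_mem b ?_
    have h3 : (longest b * w)⁻¹ * ((dual b J u : P.weylGroup) * refl P (act q⁻¹ α)) = q := by
      rw [refl_act, hdu, h]
      group
    rw [h3]
    exact hqm
  have h3 : codim b J u = length b (dual b J u : P.weylGroup) := rfl
  omega

/-! ### The linear forms -/

/-- Independence over ℚ reduces to independence over ℤ, where it is that of the variables. -/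
theorem linearIndependent_negRoot : LinearIndependent ℚ (negRoot b) := by
  rw [← LinearIndependent.iff_fractionRing ℤ ℚ]
  rw [Fintype.linearIndependent_iff]
  intro g hg
  have h := Fintype.linearIndependent_iff.mp (MvPolynomial.linearIndependent_X b.support ℤ) g
  apply h
  apply IsFractionRing.injective (MvPolynomial b.support ℤ) (RatFun b)
  rw [map_zero, ← hg, map_sum]
  refine Finset.sum_congr rfl fun i _ => ?_
  rw [zsmul_eq_mul, map_mul, map_intCast, zsmul_eq_mul]
  rfl

theorem toForm_injective : Function.Injective (toForm b) := by
  rw [← LinearMap.ker_eq_bot, LinearMap.ker_eq_bot']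
  intro x hx
  rw [toForm, Module.Basis.constr_apply_fintype] at hx
  have h := Fintype.linearIndependent_iff.mp (linearIndependent_negRoot b)
    (fun i => b.toWeightBasis.repr x i) (by
      simp only [smul_neg, Finset.sum_neg_distrib, neg_eq_zero] at hx
      exact hx)
  exact b.toWeightBasis.repr.injective (by ext i; simpa using h i)

theorem toForm_root (i : b.support) : toForm b (P.root i) = -negRoot b i := by
  rw [toForm, ← RootPairing.Base.toWeightBasis_apply, Module.Basis.constr_basis]

theorem IsNonnegForm.zero : IsNonnegForm b 0 := ⟨0, by simp⟩

theorem IsNonnegForm.add {x y : RatFun b} (hx : IsNonnegForm b x) (hy : IsNonnegForm b y) :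
    IsNonnegForm b (x + y) := by
  obtain ⟨m, rfl⟩ := hx
  obtain ⟨n, rfl⟩ := hy
  exact ⟨m + n, by simp [add_mul, Finset.sum_add_distrib]⟩

theorem isNonnegForm_toForm {x : M} (hx : -x ∈ posCone b) : IsNonnegForm b (toForm b x) := by
  suffices h : ∀ y ∈ posCone b, IsNonnegForm b (-toForm b y) by
    simpa using h _ hx
  intro y hy
  induction hy using AddSubmonoid.closure_induction with
  | mem x hx =>
    obtain ⟨j, rfl⟩ := hx
    refine ⟨Pi.single j 1, ?_⟩
    rw [toForm_root, neg_neg, Finset.sum_eq_single j] <;> simp +contextual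
  | zero => simpa using IsNonnegForm.zero b
  | add x y _ _ h1 h2 =>
    rw [map_add, neg_add]
    exact h1.add b h2

theorem chevCoef_eq (β : DivRoot b J) (w : MinRep b J) :
    chevCoef b J β w =
      toForm b (longest b • fundWeight b β - (w : P.weylGroup) • fundWeight b β) := by
  have h1 : (dual b J w : P.weylGroup) =
    longest b * w * ((longest b * w)⁻¹ * (dual b J w : P.weylGroup)) :=
    (mul_inv_cancel_left _ _).symm
  have h2 : (dual b J w : P.weylGroup) • fundWeight b β =
      longest b • (w : P.weylGroup) • fundWeight b β := by
    rw [h1, mul_smul, parabolic_smul_fundWeight b J (dual_spec b w) β.2, mul_smul]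
  rw [chevCoef, chevD_eq, h2, smul_sub, smul_smul, longest_mul_self, one_smul]

theorem F_eq (w u : MinRep b J) (β : DivRoot b J) :
    F b J w u β =
      toForm b ((u : P.weylGroup) • fundWeight b β - (w : P.weylGroup) • fundWeight b β) := by
  rw [F, chevCoef_eq, chevCoef_eq, ← map_sub, sub_sub_sub_cancel_left]

theorem exists_F_ne_zero {u w : MinRep b J} (h : u ≠ w) : ∃ β, F b J w u β ≠ 0 := by
  obtain ⟨β, hβ⟩ := exists_smul_fundWeight_ne b h
  refine ⟨β, fun h0 => hβ ?_⟩
  rw [F_eq, map_eq_zero_iff _ (toForm_injective b), sub_eq_zero] at h0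
  exact h0

/-- Cocycle relation: it reduces signs along the Bruhat order to single edges. -/
theorem F_add (w v u : MinRep b J) (β : DivRoot b J) :
    F b J w u β = F b J w v β + F b J v u β := by
  simp only [F]; ring

theorem coef_ne_zero {u w : MinRep b J} {α : ι} (hα : b.IsPos α)
    (h : (w : P.weylGroup) = u * refl P α) {β : DivRoot b J} (hF : F b J w u β ≠ 0) :
    coef b α β ≠ 0 := by
  intro h0
  apply hF
  rw [F_eq, smul_sub_smul_fundWeight b h, ← cast_coef b hα, h0]
  simp

theorem isNonnegForm_F_step {u w : MinRep b J} {α : ι} (hα : IsOuter b J α)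
    (h : (w : P.weylGroup) = u * refl P α) (hc : codim b J u < codim b J w) (β : DivRoot b J) :
    IsNonnegForm b (F b J w u β) := by
  rw [F_eq, smul_sub_smul_fundWeight b h, ← cast_coef b hα.1]
  apply isNonnegForm_toForm
  rw [← smul_neg, Nat.cast_smul_eq_nsmul]
  exact AddSubmonoid.nsmul_mem _
    (neg_root_mem_posCone b (not_isPos_act_of_codim_lt b hα h hc)) _

theorem Prec.isNonnegForm {u w : MinRep b J} (h : Prec b J u w) (β : DivRoot b J) :
    IsNonnegForm b (F b J w u β) := by
  unfold Prec at h
  induction h using Relation.ReflTransGen.head_induction_on with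
  | refl => rw [F, sub_self]; exact IsNonnegForm.zero b
  | head h' _ ih =>
    obtain ⟨α, hα, heq, hc⟩ := h'
    rw [F_add b _ _]
    exact ih.add b (isNonnegForm_F_step b hα heq hc β)

end Parabolic

/-! ### Path sums -/

section Paths

variable {ι M N : Type*} [Fintype ι] [AddCommGroup M] [Module ℚ M] [AddCommGroup N] [Module ℚ N]
  {P : RootPairing ι ℚ M N} [P.IsRootSystem] [P.IsCrystallographic] [P.IsReduced]
  (b : P.Base) {J : Set b.support}

theorem pathSum_self (w : MinRep b J) (f : ∀ v : MinRep b J, v ≠ w → DivRoot b J) :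
    pathSum b J w w f = 1 := by
  have h : (finite_paths b J w w).toFinset = {[]} := by
    ext l
    simp only [Set.Finite.mem_toFinset, Set.mem_ofPred_eq, Finset.mem_singleton]
    constructor
    · intro h
      have := length_of_isPath b J w l w h
      exact List.length_eq_zero_iff.mp (by omega)
    · rintro rfl; simp [IsPath]
  rw [pathSum, h, Finset.sum_singleton, pathWeight]

/-- A path starting at $u\ne w$ is nonempty, and splitting off its first edge is a bijection. -/
theorem pathSum_of_ne {u w : MinRep b J} (huw : u ≠ w)
    (f : ∀ v : MinRep b J, v ≠ w → DivRoot b J) :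
    pathSum b J u w f = ∑ α : ι, ∑ u₁, if ClassicalStep b J α u u₁ ∧ Prec b J u₁ w then
      edgeWeight b J w f u α * pathSum b J u₁ w f else 0 := by
  rw [← Fintype.sum_prod_type' (f := fun α u₁ =>
    if ClassicalStep b J α u u₁ ∧ Prec b J u₁ w then
      edgeWeight b J w f u α * pathSum b J u₁ w f else 0), ← Finset.sum_filter]
  simp only [pathSum, Finset.mul_sum]
  rw [Finset.sum_sigma']
  symm
  refine Finset.sum_nbij (fun x => x.1 :: x.2) ?_ ?_ ?_ ?_
  · rintro ⟨⟨α, u₁⟩, l⟩ h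
    simp only [Finset.mem_sigma, Finset.mem_filter, Finset.mem_univ, true_and,
      Set.Finite.mem_toFinset, Set.mem_ofPred_eq] at h ⊢
    exact h
  · rintro ⟨a, l⟩ _ ⟨a', l'⟩ _ h
    simp only [List.cons.injEq] at h
    obtain ⟨rfl, rfl⟩ := h
    rfl
  · rintro l hl
    simp only [Set.Finite.coe_toFinset, Set.mem_ofPred_eq] at hl
    rcases l with _ | ⟨⟨α, u₁⟩, l⟩
    · exact absurd hl huw
    · refine ⟨⟨⟨α, u₁⟩, l⟩, ?_, rfl⟩
      simp only [Finset.coe_sigma, Set.mem_sigma_iff, Finset.mem_coe, Finset.mem_filter,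
        Finset.mem_univ, true_and, Set.Finite.mem_toFinset, Set.mem_ofPred_eq]
      exact hl
  · rintro ⟨⟨α, u₁⟩, l⟩ _
    rfl

theorem ClassicalStep.prec {α : ι} {u w : MinRep b J} (h : ClassicalStep b J α u w) :
    Prec b J u w :=
  Relation.ReflTransGen.single ⟨α, h.1, h.2.1, by have := h.2.2; omega⟩

theorem ClassicalStep.prec_trans {α : ι} {u v w : MinRep b J} (h : ClassicalStep b J α u v)
    (h' : Prec b J v w) : Prec b J u w :=
  Relation.ReflTransGen.trans (h.prec b) h'

theorem Prec.codim_le {u w : MinRep b J} (h : Prec b J u w) : codim b J u ≤ codim b J w := by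
  unfold Prec at h
  induction h with
  | refl => exact le_rfl
  | tail _ h' ih =>
    obtain ⟨α, -, -, hc⟩ := h'
    omega

theorem IsPath.prec (w : MinRep b J) (l : List (ι × MinRep b J)) :
    ∀ v, IsPath b J w v l → Prec b J v w := by
  induction l with
  | nil => intro v h; simp only [IsPath] at h; rw [h]; exact Relation.ReflTransGen.refl
  | cons a l ih =>
    intro v h
    obtain ⟨α, v'⟩ := a
    simp only [IsPath] at h
    exact h.1.1.prec_trans b h.1.2

theorem prec_of_pathSum_ne_zero {u w : MinRep b J} {f : ∀ v : MinRep b J, v ≠ w → DivRoot b J}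
    (h : pathSum b J u w f ≠ 0) : Prec b J u w := by
  obtain ⟨l, hl, -⟩ := Finset.exists_ne_zero_of_sum_ne_zero h
  exact IsPath.prec b w l u (by simpa using hl)

/-! ### Positivity of rational functions -/

/-- The value of a polynomial when all variables are one. -/
def evalOne : MvPolynomial b.support ℤ →+* ℤ := MvPolynomial.eval fun _ => 1

/-- A fraction whose numerator is nonnegative, and whose denominator is positive, when all
variables are one. -/
def IsNonnegRat (x : RatFun b) : Prop :=
  ∃ p q, 0 ≤ evalOne b p ∧ 0 < evalOne b q ∧ x = algebraMap _ (RatFun b) p / algebraMap _ _ q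

/-- A fraction whose numerator and denominator are positive when all variables are one. -/
def IsPosRat (x : RatFun b) : Prop :=
  ∃ p q, 0 < evalOne b p ∧ 0 < evalOne b q ∧ x = algebraMap _ (RatFun b) p / algebraMap _ _ q

variable {b}

theorem algebraMap_ne_zero_of_evalOne_pos {q : MvPolynomial b.support ℤ} (h : 0 < evalOne b q) :
    algebraMap _ (RatFun b) q ≠ 0 := by
  intro h0
  rw [map_eq_zero_iff _ (IsFractionRing.injective (MvPolynomial b.support ℤ) (RatFun b))] at h0
  rw [h0, map_zero] at h
  exact lt_irrefl _ h

theorem IsPosRat.nonneg {x : RatFun b} (h : IsPosRat b x) : IsNonnegRat b x := by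
  obtain ⟨p, q, hp, hq, rfl⟩ := h
  exact ⟨p, q, hp.le, hq, rfl⟩

theorem IsPosRat.ne_zero {x : RatFun b} (h : IsPosRat b x) : x ≠ 0 := by
  obtain ⟨p, q, hp, hq, rfl⟩ := h
  exact div_ne_zero (algebraMap_ne_zero_of_evalOne_pos hp) (algebraMap_ne_zero_of_evalOne_pos hq)

theorem IsPosRat.one : IsPosRat b 1 := ⟨1, 1, by simp, by simp, by simp⟩

theorem IsNonnegRat.zero : IsNonnegRat b 0 := ⟨0, 1, by simp, by simp, by simp⟩

theorem IsNonnegRat.add {x y : RatFun b} (hx : IsNonnegRat b x) (hy : IsNonnegRat b y) :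
    IsNonnegRat b (x + y) := by
  obtain ⟨p, q, hp, hq, rfl⟩ := hx
  obtain ⟨p', q', hp', hq', rfl⟩ := hy
  refine ⟨p * q' + q * p', q * q', ?_, ?_, ?_⟩
  · simp only [map_add, map_mul]; positivity
  · simp only [map_mul]; positivity
  · rw [div_add_div _ _ (algebraMap_ne_zero_of_evalOne_pos hq)
      (algebraMap_ne_zero_of_evalOne_pos hq')]
    simp only [map_add, map_mul]

theorem IsPosRat.add_nonneg {x y : RatFun b} (hx : IsPosRat b x) (hy : IsNonnegRat b y) :
    IsPosRat b (x + y) := by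
  obtain ⟨p, q, hp, hq, rfl⟩ := hx
  obtain ⟨p', q', hp', hq', rfl⟩ := hy
  refine ⟨p * q' + q * p', q * q', ?_, ?_, ?_⟩
  · simp only [map_add, map_mul]; positivity
  · simp only [map_mul]; positivity
  · rw [div_add_div _ _ (algebraMap_ne_zero_of_evalOne_pos hq)
      (algebraMap_ne_zero_of_evalOne_pos hq')]
    simp only [map_add, map_mul]

theorem IsNonnegRat.mul {x y : RatFun b} (hx : IsNonnegRat b x) (hy : IsNonnegRat b y) :
    IsNonnegRat b (x * y) := by
  obtain ⟨p, q, hp, hq, rfl⟩ := hx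
  obtain ⟨p', q', hp', hq', rfl⟩ := hy
  refine ⟨p * p', q * q', ?_, ?_, ?_⟩
  · simp only [map_mul]; positivity
  · simp only [map_mul]; positivity
  · rw [div_mul_div_comm]; simp only [map_mul]

theorem IsPosRat.mul {x y : RatFun b} (hx : IsPosRat b x) (hy : IsPosRat b y) :
    IsPosRat b (x * y) := by
  obtain ⟨p, q, hp, hq, rfl⟩ := hx
  obtain ⟨p', q', hp', hq', rfl⟩ := hy
  refine ⟨p * p', q * q', ?_, ?_, ?_⟩
  · simp only [map_mul]; positivity
  · simp only [map_mul]; positivity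
  · rw [div_mul_div_comm]; simp only [map_mul]

theorem IsPosRat.inv {x : RatFun b} (hx : IsPosRat b x) : IsPosRat b x⁻¹ := by
  obtain ⟨p, q, hp, hq, rfl⟩ := hx
  exact ⟨q, p, hq, hp, inv_div _ _⟩

theorem IsNonnegRat.natCast (n : ℕ) : IsNonnegRat b n := ⟨n, 1, by simp, by simp, by simp⟩

theorem IsPosRat.natCast {n : ℕ} (h : n ≠ 0) : IsPosRat b n :=
  ⟨n, 1, by simpa using Nat.pos_of_ne_zero h, by simp, by simp⟩

theorem IsNonnegRat.sum {κ : Type*} {s : Finset κ} {g : κ → RatFun b}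
    (h : ∀ i ∈ s, IsNonnegRat b (g i)) : IsNonnegRat b (∑ i ∈ s, g i) :=
  Finset.sum_induction g _ (fun _ _ => IsNonnegRat.add) IsNonnegRat.zero h

theorem IsPosRat.sum {κ : Type*} {s : Finset κ} {g : κ → RatFun b}
    (h : ∀ i ∈ s, IsNonnegRat b (g i)) {i : κ} (hi : i ∈ s) (hp : IsPosRat b (g i)) :
    IsPosRat b (∑ i ∈ s, g i) := by
  rw [← Finset.add_sum_erase s g hi]
  exact hp.add_nonneg (IsNonnegRat.sum fun j hj => h j (Finset.mem_of_mem_erase hj))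

theorem IsNonnegForm.isPosRat {x : RatFun b} (h : IsNonnegForm b x) (h0 : x ≠ 0) :
    IsPosRat b x := by
  obtain ⟨n, rfl⟩ := h
  refine ⟨∑ i, (n i : MvPolynomial b.support ℤ) * MvPolynomial.X i, 1, ?_, by simp, ?_⟩
  · obtain ⟨i, -, hi⟩ := Finset.exists_ne_zero_of_sum_ne_zero h0
    have hn : n i ≠ 0 := by
      intro h1
      rw [h1] at hi
      simp at hi
    have h1 : evalOne b (∑ i, (n i : MvPolynomial b.support ℤ) * MvPolynomial.X i) =
        ∑ i, (n i : ℤ) := by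
      simp [evalOne]
    rw [h1]
    exact Finset.sum_pos' (fun _ _ => by positivity) ⟨i, Finset.mem_univ _, by positivity⟩
  · simp [negRoot]

theorem IsNonnegForm.isNonnegRat {x : RatFun b} (h : IsNonnegForm b x) : IsNonnegRat b x := by
  by_cases h0 : x = 0
  · rw [h0]; exact IsNonnegRat.zero
  · exact (h.isPosRat h0).nonneg

/-! ### Existence of the choices -/

variable (b J)

theorem exists_isSelector : ∃ sel : Selector b J, IsSelector b J sel :=
  ⟨fun _ _ h => (exists_F_ne_zero b h).choose, fun _ _ h => (exists_F_ne_zero b h).choose_spec⟩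

variable {b J}

/-- Paths of classical steps. -/
def ClassicalChain (u w : MinRep b J) : Prop :=
  Relation.ReflTransGen (fun v v' : MinRep b J => ∃ α, ClassicalStep b J α v v') u w

theorem ClassicalChain.prec {u w : MinRep b J} (h : ClassicalChain u w) : Prec b J u w := by
  unfold ClassicalChain at h
  induction h with
  | refl => exact Relation.ReflTransGen.refl
  | tail _ h' ih =>
    obtain ⟨α, h'⟩ := h'
    exact Relation.ReflTransGen.trans ih (h'.prec b)

theorem classicalChain_unitRep (w : MinRep b J) : ClassicalChain (unitRep b J) w := by
  induction hn : codim b J w generalizing w with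
  | zero => rw [eq_unitRep_of_codim_eq_zero b hn]; exact Relation.ReflTransGen.refl
  | succ n ih =>
    obtain ⟨α, w', h⟩ := exists_classicalStep b (w := w) (by omega)
    exact Relation.ReflTransGen.tail (ih w' (by have := h.2.2; omega)) ⟨α, h⟩

/-- Choose $\beta$ with $F_{v',v}(\beta)\ne0$ for the first step $v\to v'$ of a chain to $w$. This
forces $h_\alpha(\omega_\beta)\ne0$ on that step, and $F_{w,v}(\beta)$ is a nonzero nonnegative form
plus a nonnegative one, so it cannot cancel. -/
theorem exists_good_divRoot (w v : MinRep b J) (hv : v ≠ w) :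
    ∃ β : DivRoot b J, F b J w v β ≠ 0 ∧ (ClassicalChain v w →
      ∃ α v', ClassicalStep b J α v v' ∧ ClassicalChain v' w ∧ coef b α β ≠ 0) := by
  by_cases h : ClassicalChain v w
  · rcases Relation.ReflTransGen.cases_head h with h1 | ⟨v', ⟨α, h1⟩, h2⟩
    · exact absurd h1 hv
    · have hne : v ≠ v' := by
        rintro rfl
        have := h1.2.2
        omega
      obtain ⟨β, hβ⟩ := exists_F_ne_zero b hne
      refine ⟨β, ?_, fun _ => ⟨α, v', h1, h2, coef_ne_zero b h1.1.1 h1.2.1 hβ⟩⟩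
      rw [F_add b w v' v, add_comm]
      have hpos : IsPosRat b (F b J v' v β) := ((h1.prec b).isNonnegForm b β).isPosRat hβ
      exact (hpos.add_nonneg
        ((ClassicalChain.prec (w := w) h2).isNonnegForm b β).isNonnegRat).ne_zero
  · obtain ⟨β, hβ⟩ := exists_F_ne_zero b hv
    exact ⟨β, hβ, fun h' => absurd h' h⟩

theorem isNonnegRat_edgeWeight {w v : MinRep b J} {f : ∀ v : MinRep b J, v ≠ w → DivRoot b J}
    (h : Prec b J v w) (α : ι) : IsNonnegRat b (edgeWeight b J w f v α) := by
  rw [edgeWeight]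
  split_ifs with hv
  · exact IsNonnegRat.zero
  · rw [div_eq_mul_inv]
    refine (IsNonnegRat.natCast _).mul ?_
    -- A vanishing denominator gives weight $0$ by the convention for division, so nonnegativity
    -- holds for any $f$.
    by_cases h0 : F b J w v (f v hv) = 0
    · rw [h0, inv_zero]; exact IsNonnegRat.zero
    · exact ((h.isNonnegForm b _).isPosRat h0).inv.nonneg

theorem isNonnegRat_pathSum {u w : MinRep b J} (f : ∀ v : MinRep b J, v ≠ w → DivRoot b J)
    (h : Prec b J u w) : IsNonnegRat b (pathSum b J u w f) := by
  induction hn : codim b J w - codim b J u generalizing u with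
  | zero =>
    by_cases huw : u = w
    · subst huw; rw [pathSum_self]; exact IsPosRat.one.nonneg
    · rw [pathSum_of_ne b huw]
      refine IsNonnegRat.sum fun α _ => IsNonnegRat.sum fun u₁ _ => ?_
      split_ifs with hs
      · have h1 := hs.1.2.2
        have h2 := hs.2.codim_le b
        omega
      · exact IsNonnegRat.zero
  | succ n ih =>
    have huw : u ≠ w := by rintro rfl; omega
    rw [pathSum_of_ne b huw]
    refine IsNonnegRat.sum fun α _ => IsNonnegRat.sum fun u₁ _ => ?_
    split_ifs with hs
    · exact (isNonnegRat_edgeWeight h α).mul (ih hs.2 (by have := hs.1.2.2; omega))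
    · exact IsNonnegRat.zero

variable (b J)

theorem exists_isGoodAssignments : ∃ f : Assignments b J, IsGoodAssignments b J f := by
  refine ⟨fun w v hv => (exists_good_divRoot w v hv).choose, fun w => ⟨fun v hv _ h =>
    ⟨(exists_good_divRoot w v hv).choose_spec.1, h.isNonnegForm b _⟩, ?_⟩⟩
  set f : ∀ v : MinRep b J, v ≠ w → DivRoot b J :=
    fun v hv => (exists_good_divRoot w v hv).choose with hf
  -- Positivity is carried backwards along the chain: the edge chosen at $u$ contributes a positive
  -- summand, and all other edges nonnegative ones.
  suffices h : ∀ n (u : MinRep b J), ClassicalChain u w → codim b J w - codim b J u = n →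
      IsPosRat b (pathSum b J u w f) from
    (h _ _ (classicalChain_unitRep w) rfl).ne_zero
  intro n
  induction n using Nat.strong_induction_on with
  | _ n ih =>
    intro u hu hn
    by_cases huw : u = w
    · subst huw; rw [pathSum_self]; exact IsPosRat.one
    · have hnn : ∀ (α : ι) (u₁ : MinRep b J),
          IsNonnegRat b (if ClassicalStep b J α u u₁ ∧ Prec b J u₁ w then
            edgeWeight b J w f u α * pathSum b J u₁ w f else 0) := by
        intro α u₁
        split_ifs with hs
        · exact (isNonnegRat_edgeWeight hu.prec α).mul (isNonnegRat_pathSum f hs.2)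
        · exact IsNonnegRat.zero
      obtain ⟨hF, hstep⟩ := (exists_good_divRoot w u huw).choose_spec
      obtain ⟨α, v, h1, h2, h3⟩ := hstep hu
      rw [pathSum_of_ne b huw]
      refine IsPosRat.sum (fun α _ => IsNonnegRat.sum fun u₁ _ => hnn α u₁) (Finset.mem_univ α) ?_
      refine IsPosRat.sum (fun u₁ _ => hnn α u₁) (Finset.mem_univ v) ?_
      rw [if_pos ⟨h1, ClassicalChain.prec h2⟩, edgeWeight, dif_neg huw, div_eq_mul_inv]
      refine ((IsPosRat.natCast h3).mul
        ((hu.prec.isNonnegForm b _).isPosRat hF).inv).mul (ih _ ?_ v h2 rfl)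
      have h4 := h1.2.2
      have h5 := (ClassicalChain.prec h2).codim_le b
      omega

end Paths

/-! ### Agreement of the algorithm with every solution of (a), (b), (c). -/

section Correctness

variable {ι M N : Type*} [Fintype ι] [AddCommGroup M] [Module ℚ M] [AddCommGroup N] [Module ℚ N]
  {P : RootPairing ι ℚ M N} [P.IsRootSystem] [P.IsCrystallographic] [P.IsReduced]
  {b : P.Base} {J : Set b.support}

theorem codim_le_maxCodim (u : MinRep b J) : codim b J u ≤ maxCodim b J :=
  Finset.le_sup (f := codim b J) (Finset.mem_univ u)

theorem upSum_congr {β : DivRoot b J} {u : MinRep b J} {g g' : MinRep b J → RatFun b}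
    (h : ∀ α u₁, ClassicalStep b J α u u₁ → g u₁ = g' u₁) :
    upSum b J β u g = upSum b J β u g' := by
  refine Finset.sum_congr rfl fun α _ => Finset.sum_congr rfl fun u₁ _ => ?_
  split_ifs with hs
  · rw [h α u₁ hs]
  · rfl

theorem downSum_congr {β : DivRoot b J} {w : MinRep b J} {g g' : MinRep b J → RatFun b}
    (h : ∀ α w₁, ClassicalStep b J α w₁ w → g w₁ = g' w₁) :
    downSum b J β w g = downSum b J β w g' := by
  refine Finset.sum_congr rfl fun α _ => Finset.sum_congr rfl fun w₁ _ => ?_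
  split_ifs with hs
  · rw [h α w₁ hs]
  · rfl

theorem IsEQLR.eq_div {c : Coeffs b J} (hc : IsEQLR b J c) {u w : MinRep b J} (huw : u ≠ w)
    {β : DivRoot b J} (hF : F b J w u β ≠ 0) (v : MinRep b J) (d : Deg b J) :
    c u v w d = (upSum b J β u (fun u₁ => c u₁ v w d) - downSum b J β w (fun w₁ => c u v w₁ d)
      + lowTerm b J c β u v w d) / F b J w u β := by
  rw [hc.recursion u v w d β huw hF, lowTerm]
  ring

/-! ### The values of the recursions -/

/-- The relation $u\not\prec w$ persists when $u$ goes up or $w$ goes down, so the branch $u=w$ is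
never entered. Each step raises $c(u)-c(w)$ by one, and the bound on `n` ensures that the default
value at `n = 0` is never used. -/
theorem offTerm_eq {c : Coeffs b J} (hc : IsEQLR b J c) {sel : Selector b J}
    (hsel : IsSelector b J sel) (d : Deg b J) (n : ℕ) :
    ∀ u v w : MinRep b J, ¬ Prec b J u w → maxCodim b J + codim b J w < n + codim b J u →
      offTerm b J sel c d n u v w = c u v w d := by
  induction n with
  | zero =>
    intro u v w _ h
    have := codim_le_maxCodim u
    omega
  | succ n ih =>
    intro u v w hp h
    have huw : u ≠ w := by rintro rfl; exact hp Relation.ReflTransGen.refl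
    rw [offTerm, dif_neg huw, hc.eq_div huw (hsel u w huw) v d]
    congr 3
    · refine upSum_congr fun α u₁ hs => ih _ _ _ (fun h' => hp (hs.prec_trans b h')) ?_
      have := hs.2.2
      omega
    · refine downSum_congr fun α w₁ hs => ih _ _ _ (fun h' => hp (h'.trans (hs.prec b))) ?_
      have := hs.2.2
      omega

theorem offE_eq {c : Coeffs b J} (hc : IsEQLR b J c) {sel : Selector b J}
    (hsel : IsSelector b J sel) (d : Deg b J) {u w : MinRep b J} (v : MinRep b J)
    (h : ¬ Prec b J u w) : offE b J sel c d u v w = c u v w d := by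
  refine offTerm_eq hc hsel d _ u v w h ?_
  have := codim_le_maxCodim w
  omega

/-- The steps that stay below $w$ continue paths of the graph; the others leave it and are covered
by `offTerm_eq`. -/
theorem upSum_div_split {w u : MinRep b J} (huw : u ≠ w)
    (f : ∀ v : MinRep b J, v ≠ w → DivRoot b J) (g : MinRep b J → RatFun b) :
    upSum b J (f u huw) u g / F b J w u (f u huw) =
      (∑ α : ι, ∑ u₁, if ClassicalStep b J α u u₁ ∧ Prec b J u₁ w then
          edgeWeight b J w f u α * g u₁ else 0)
        + upSum b J (f u huw) u (fun u₁ => if Prec b J u₁ w then 0 else g u₁) /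
          F b J w u (f u huw) := by
  simp only [upSum, Finset.sum_div, ← Finset.sum_add_distrib]
  refine Finset.sum_congr rfl fun α _ => Finset.sum_congr rfl fun u₁ _ => ?_
  rw [edgeWeight, dif_neg huw]
  by_cases h1 : ClassicalStep b J α u u₁ <;> by_cases h2 : Prec b J u₁ w <;>
    simp [h1, h2, div_mul_eq_mul_div]

theorem eq_pathSum_mul_add_pathTerm {c : Coeffs b J} (hc : IsEQLR b J c) {sel : Selector b J}
    (hsel : IsSelector b J sel) (d : Deg b J) {x w : MinRep b J}
    {f : ∀ v : MinRep b J, v ≠ w → DivRoot b J} (hf : IsAssignment b J x w f) (n : ℕ) :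
    ∀ u : MinRep b J, Prec b J x u → Prec b J u w → codim b J w < n + codim b J u →
      c u w w d = pathSum b J u w f * c w w w d + pathTerm b J sel c d w f n u := by
  induction n with
  | zero =>
    intro u _ hu h
    have := hu.codim_le b
    omega
  | succ n ih =>
    intro u hxu huw h
    by_cases hne : u = w
    · subst hne
      rw [pathSum_self, pathTerm, dif_pos rfl, one_mul, add_zero]
    · rw [pathTerm, dif_neg hne, hc.eq_div hne (hf u hne hxu huw).1 w d, add_div, sub_div,
        upSum_div_split hne f]
      have h1 : (∑ α : ι, ∑ u₁, if ClassicalStep b J α u u₁ ∧ Prec b J u₁ w then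
            edgeWeight b J w f u α * c u₁ w w d else 0) =
          pathSum b J u w f * c w w w d +
          ∑ α : ι, ∑ u₁, if ClassicalStep b J α u u₁ ∧ Prec b J u₁ w then
            edgeWeight b J w f u α * pathTerm b J sel c d w f n u₁ else 0 := by
        rw [pathSum_of_ne b hne]
        simp only [Finset.sum_mul, ← Finset.sum_add_distrib]
        refine Finset.sum_congr rfl fun α _ => Finset.sum_congr rfl fun u₁ _ => ?_
        split_ifs with hs
        · rw [ih u₁ (hxu.trans (hs.1.prec b)) hs.2 (by have := hs.1.2.2; omega)]
          ring
        · ring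
      have h2 : upSum b J (f u hne) u (fun u₁ => if Prec b J u₁ w then 0 else c u₁ w w d) =
          upSum b J (f u hne) u
            (fun u₁ => if Prec b J u₁ w then 0 else offE b J sel c d u₁ w w) := by
        refine upSum_congr fun α u₁ _ => ?_
        split_ifs with hp
        · rfl
        · rw [offE_eq hc hsel d w hp]
      have h3 : downSum b J (f u hne) w (fun w₁ => c u w w₁ d) =
          downSum b J (f u hne) w (fun w₁ => offE b J sel c d w u w₁) := by
        refine downSum_congr fun α w₁ hs => ?_
        -- Commutativity puts $w$ in the first place, and $w\not\prec w_1$ because $c(w_1)<c(w)$.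
        rw [hc.comm, offE_eq hc hsel d u]
        intro hp
        have h4 := hp.codim_le b
        have h5 := hs.2.2
        omega
      rw [h1, h2, h3]
      ring

theorem diagValue_eq {c : Coeffs b J} (hc : IsEQLR b J c) {sel : Selector b J}
    (hsel : IsSelector b J sel) {f : Assignments b J} (hf : IsGoodAssignments b J f)
    (d : Deg b J) (w : MinRep b J) : diagValue b J sel f c d w = c w w w d := by
  obtain ⟨h1, h2⟩ := hf w
  have h3 := eq_pathSum_mul_add_pathTerm hc hsel d h1 (maxCodim b J + 1) (unitRep b J)
    Relation.ReflTransGen.refl (prec_of_pathSum_ne_zero b h2)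
    (by have := codim_le_maxCodim w; omega)
  rw [hc.unit] at h3
  rw [diagValue, h3, pathE, add_sub_cancel_right, mul_div_cancel_left₀ _ h2]

/-- Every step raises $c(u)+c(v)-c(w)$ by one, and this number is at most $2\dim$. The only
coefficients on which (c) cannot be used, even after (b), have $u=v=w$ and are known by
`diagValue_eq`. -/
theorem fullTerm_eq {c : Coeffs b J} (hc : IsEQLR b J c) {sel : Selector b J}
    (hsel : IsSelector b J sel) {f : Assignments b J} (hf : IsGoodAssignments b J f)
    (d : Deg b J) (n : ℕ) :
    ∀ u v w : MinRep b J, 2 * maxCodim b J + codim b J w < n + codim b J u + codim b J v →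
      fullTerm b J sel f c d n u v w = c u v w d := by
  induction n with
  | zero =>
    intro u v w h
    have := codim_le_maxCodim u
    have := codim_le_maxCodim v
    omega
  | succ n ih =>
    intro u v w h
    rw [fullTerm]
    split_ifs with hu hv
    · subst hu hv
      exact diagValue_eq hc hsel hf d _
    · rw [hc.comm u v, hc.eq_div hv (hsel v w hv) u d]
      congr 3
      · exact upSum_congr fun α v₁ hs => ih _ _ _ (by have := hs.2.2; omega)
      · exact downSum_congr fun α w₁ hs => ih _ _ _ (by have := hs.2.2; omega)
    · rw [hc.eq_div hu (hsel u w hu) v d]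
      congr 3
      · exact upSum_congr fun α v₁ hs => ih _ _ _ (by have := hs.2.2; omega)
      · exact downSum_congr fun α w₁ hs => ih _ _ _ (by have := hs.2.2; omega)

/-! ### Operators that only involve smaller multidegrees -/

variable (b J)

/-- Operators that produce a function of the multidegree from a family of coefficients. -/
abbrev Operator : Type _ := Coeffs b J → Deg b J → RatFun b

/-- Triples of representatives. -/
abbrev Triple : Type _ := MinRep b J × MinRep b J × MinRep b J

/-- The operator that shifts the multidegree of the coefficients with a given triple. -/
def shiftOp (e : Deg b J) (s : Triple b J) : Operator b J :=
  fun c d => if e ≤ d then c s.1 s.2.1 s.2.2 (d - e) else 0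

/-- The nontrivial shifts, and the constant operator with value `δ_{d,0}`. -/
def generator : Option ({e : Deg b J // e ≠ 0} × Triple b J) → Operator b J
  | none => fun _ d => if d = 0 then 1 else 0
  | some (e, s) => shiftOp b J e s

/-- The combinations of nontrivial shifts. -/
def lowOperators : Submodule (RatFun b) (Operator b J) :=
  Submodule.span _ (Set.range fun x => generator b J (some x))

/-- The combinations of nontrivial shifts and the constant operator with value `δ_{d,0}`. -/
def recOperators : Submodule (RatFun b) (Operator b J) :=
  Submodule.span _ (Set.range (generator b J))

theorem lowOperators_le : lowOperators b J ≤ recOperators b J := by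
  refine Submodule.span_mono ?_
  rintro _ ⟨x, rfl⟩
  exact ⟨some x, rfl⟩

variable {b J} {V : Submodule (RatFun b) (Operator b J)}

theorem operator_sum_mem {κ : Type*} [Fintype κ] {g : κ → Operator b J} (h : ∀ i, g i ∈ V) :
    (fun c d => ∑ i, g i c d) ∈ V := by
  have := V.sum_mem (t := Finset.univ) fun i _ => h i
  convert this using 1
  ext c d
  simp [Finset.sum_apply]

theorem operator_ite_mem {p : Prop} [Decidable p] {g : Operator b J} (h : p → g ∈ V) :
    (fun c d => if p then g c d else 0) ∈ V := by
  by_cases hp : p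
  · simpa only [if_pos hp] using h hp
  · simp only [if_neg hp]
    exact V.zero_mem

theorem operator_ite_mem' {p : Prop} [Decidable p] {g : Operator b J} (h : ¬ p → g ∈ V) :
    (fun c d => if p then 0 else g c d) ∈ V := by
  by_cases hp : p
  · simp only [if_pos hp]
    exact V.zero_mem
  · simpa only [if_neg hp] using h hp

theorem operator_mul_mem (a : RatFun b) {g : Operator b J} (h : g ∈ V) :
    (fun c d => a * g c d) ∈ V :=
  V.smul_mem a h

theorem operator_div_mem (a : RatFun b) {g : Operator b J} (h : g ∈ V) :
    (fun c d => g c d / a) ∈ V := by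
  convert V.smul_mem a⁻¹ h using 1
  ext c d
  simp [div_eq_inv_mul]

theorem operator_add_mem {g g' : Operator b J} (h : g ∈ V) (h' : g' ∈ V) :
    (fun c d => g c d + g' c d) ∈ V :=
  V.add_mem h h'

theorem operator_sub_mem {g g' : Operator b J} (h : g ∈ V) (h' : g' ∈ V) :
    (fun c d => g c d - g' c d) ∈ V :=
  V.sub_mem h h'

theorem operator_upSum_mem (β : DivRoot b J) (u : MinRep b J) {g : MinRep b J → Operator b J}
    (h : ∀ u₁, g u₁ ∈ V) : (fun c d => upSum b J β u (fun u₁ => g u₁ c d)) ∈ V :=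
  operator_sum_mem fun _ => operator_sum_mem fun u₁ => operator_ite_mem fun _ =>
    operator_mul_mem _ (h u₁)

theorem operator_downSum_mem (β : DivRoot b J) (w : MinRep b J) {g : MinRep b J → Operator b J}
    (h : ∀ w₁, g w₁ ∈ V) : (fun c d => downSum b J β w (fun w₁ => g w₁ c d)) ∈ V :=
  operator_sum_mem fun _ => operator_sum_mem fun w₁ => operator_ite_mem fun _ =>
    operator_mul_mem _ (h w₁)

/-- A term with $d(\alpha)=0$ would not lower the multidegree, but its factor
$h_\alpha(\omega_\beta)$ is a component of $d(\alpha)$ and vanishes. -/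
theorem quantum_shift_mem (p : Prop) (α : ι) (β : DivRoot b J) (s : Triple b J) :
    (fun (c : Coeffs b J) d => if p ∧ rootDeg b J α ≤ d then
      (coef b α β : RatFun b) * c s.1 s.2.1 s.2.2 (d - rootDeg b J α) else 0) ∈
      lowOperators b J := by
  by_cases h0 : coef b α β = 0
  · simp only [h0, Nat.cast_zero, zero_mul, ite_self]
    exact Submodule.zero_mem _
  · have hne : rootDeg b J α ≠ 0 := fun h => h0 (congrFun h β)
    have hs : shiftOp b J (rootDeg b J α) s ∈ lowOperators b J :=
      Submodule.subset_span ⟨(⟨_, hne⟩, s), rfl⟩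
    convert operator_ite_mem (p := p) (fun _ => operator_mul_mem (coef b α β : RatFun b) hs) using 1
    ext c d
    rw [shiftOp]
    by_cases hp : p <;> by_cases hd : rootDeg b J α ≤ d <;> simp [hp, hd]

theorem lowTerm_mem (β : DivRoot b J) (u v w : MinRep b J) :
    (fun c d => lowTerm b J c β u v w d) ∈ lowOperators b J :=
  operator_sub_mem
    (operator_sum_mem fun α => operator_sum_mem fun u₂ => quantum_shift_mem _ α β (u₂, v, w))
    (operator_sum_mem fun α => operator_sum_mem fun w₂ => quantum_shift_mem _ α β (u, v, w₂))

variable (sel : Selector b J)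

theorem offTerm_mem (n : ℕ) : ∀ u v w : MinRep b J,
    (fun c d => offTerm b J sel c d n u v w) ∈ lowOperators b J := by
  induction n with
  | zero => intro u v w; exact Submodule.zero_mem _
  | succ n ih =>
    intro u v w
    simp only [offTerm]
    split_ifs with h
    · exact Submodule.zero_mem _
    · exact operator_div_mem _ (operator_add_mem (operator_sub_mem
        (operator_upSum_mem _ _ fun u₁ => ih u₁ v w)
        (operator_downSum_mem _ _ fun w₁ => ih u v w₁)) (lowTerm_mem _ u v w))

theorem pathTerm_mem {w : MinRep b J} (f : ∀ v : MinRep b J, v ≠ w → DivRoot b J) (n : ℕ) :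
    ∀ u : MinRep b J, (fun c d => pathTerm b J sel c d w f n u) ∈ lowOperators b J := by
  induction n with
  | zero => intro u; exact Submodule.zero_mem _
  | succ n ih =>
    intro u
    simp only [pathTerm]
    split_ifs with h
    · exact Submodule.zero_mem _
    · exact operator_add_mem
        (operator_sum_mem fun α => operator_sum_mem fun u₁ => operator_ite_mem fun _ =>
          operator_mul_mem _ (ih u₁))
        (operator_div_mem _ (operator_add_mem (operator_sub_mem
          (operator_upSum_mem _ _ fun u₁ => operator_ite_mem' fun _ => offTerm_mem sel _ u₁ w w)
          (operator_downSum_mem _ _ fun w₁ => offTerm_mem sel _ w u w₁)) (lowTerm_mem _ u w w)))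

variable (f : Assignments b J)

theorem diagValue_mem (w : MinRep b J) :
    (fun c d => diagValue b J sel f c d w) ∈ recOperators b J :=
  operator_div_mem _ (operator_sub_mem (Submodule.subset_span ⟨none, rfl⟩)
    (lowOperators_le b J (pathTerm_mem sel (f w) _ _)))

theorem fullTerm_mem (n : ℕ) : ∀ u v w : MinRep b J,
    (fun c d => fullTerm b J sel f c d n u v w) ∈ recOperators b J := by
  induction n with
  | zero => intro u v w; exact Submodule.zero_mem _
  | succ n ih =>
    intro u v w
    simp only [fullTerm]
    split_ifs with hu hv
    · exact diagValue_mem sel f w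
    · exact operator_div_mem _ (operator_add_mem (operator_sub_mem
        (operator_upSum_mem _ _ fun v₁ => ih v₁ u w)
        (operator_downSum_mem _ _ fun w₁ => ih v u w₁))
        (lowOperators_le b J (lowTerm_mem _ v u w)))
    · exact operator_div_mem _ (operator_add_mem (operator_sub_mem
        (operator_upSum_mem _ _ fun u₁ => ih u₁ v w)
        (operator_downSum_mem _ _ fun w₁ => ih u v w₁))
        (lowOperators_le b J (lowTerm_mem _ u v w)))

variable {sel f}

theorem operator_apply_zero {g : Operator b J} (h : g ∈ lowOperators b J) (c : Coeffs b J) :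
    g c 0 = 0 := by
  refine Submodule.span_induction (p := fun g _ => g c 0 = 0) ?_ rfl ?_ ?_ h
  · rintro _ ⟨⟨e, s⟩, rfl⟩
    exact if_neg fun he => e.2 (le_antisymm he bot_le)
  · intro g g' _ _ hg hg'
    change g c 0 + g' c 0 = 0
    rw [hg, hg', add_zero]
  · intro a g _ hg
    change a * g c 0 = 0
    rw [hg, mul_zero]

theorem sum_tsub_lt {κ : Type*} [Fintype κ] {d e : κ → ℕ} (he : e ≠ 0) (hed : e ≤ d) :
    ∑ β, (d - e) β < ∑ β, d β := by
  obtain ⟨β, hβ⟩ := Function.ne_iff.mp he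
  refine Finset.sum_lt_sum (fun i _ => Nat.sub_le _ _) ⟨β, Finset.mem_univ _, ?_⟩
  have : e β ≠ 0 := hβ
  have : e β ≤ d β := hed β
  simp only [Pi.sub_apply]
  omega

/-- A nontrivial shift strictly lowers $\sum d_\beta$, and the constant generator ignores the
family. This is what makes the induction on the multidegree well founded. -/
theorem operator_congr {g : Operator b J} (h : g ∈ recOperators b J) {c c' : Coeffs b J}
    {d : Deg b J} (hcc : ∀ u v w d', ∑ β, d' β < ∑ β, d β → c u v w d' = c' u v w d') :
    g c d = g c' d := by
  refine Submodule.span_induction (p := fun g _ => g c d = g c' d) ?_ rfl ?_ ?_ h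
  · rintro _ ⟨_ | ⟨e, s⟩, rfl⟩
    · rfl
    · simp only [generator, shiftOp]
      split_ifs with hed
      · exact hcc _ _ _ _ (sum_tsub_lt e.2 hed)
      · rfl
  · intro g g' _ _ hg hg'
    change g c d + g' c d = g c' d + g' c' d
    rw [hg, hg']
  · intro a g _ hg
    change a * g c d = a * g c' d
    rw [hg]

theorem table_congr (k : ℕ) : ∀ (k' : ℕ) (u v w : MinRep b J) (d : Deg b J),
    ∑ β, d β < k → ∑ β, d β < k' → table b J sel f k u v w d = table b J sel f k' u v w d := by
  induction k with
  | zero => intro k' u v w d h; omega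
  | succ k ih =>
    intro k' u v w d h h'
    obtain ⟨k', rfl⟩ : ∃ j, k' = j + 1 := ⟨k' - 1, by omega⟩
    exact operator_congr (fullTerm_mem sel f _ u v w)
      fun u v w d' hd' => ih k' u v w d' (by omega) (by omega)

/-- The output of the algorithm satisfies a linear recursion in the multidegree. -/
theorem algorithm_eq (u v w : MinRep b J) (d : Deg b J) :
    algorithm b J sel f u v w d =
      fullTerm b J sel f (algorithm b J sel f) d (3 * maxCodim b J + 1) u v w :=
  operator_congr (fullTerm_mem sel f _ u v w)
    fun u v w d' hd' => table_congr _ _ u v w d' hd' (by omega)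

theorem IsEQLR.eq_algorithm {c : Coeffs b J} (hc : IsEQLR b J c) (hsel : IsSelector b J sel)
    (hf : IsGoodAssignments b J f) : c = algorithm b J sel f := by
  suffices h : ∀ k, ∀ (u v w : MinRep b J) (d : Deg b J), ∑ β, d β < k →
      algorithm b J sel f u v w d = c u v w d by
    funext u v w d
    exact (h _ u v w d (Nat.lt_succ_self _)).symm
  intro k
  induction k with
  | zero => intro u v w d h; omega
  | succ k ih =>
    intro u v w d h
    -- Both families are fixed by the same round of the algorithm, so agreement passes from smaller
    -- multidegrees to $d$.
    rw [algorithm_eq, ← fullTerm_eq hc hsel hf d (3 * maxCodim b J + 1) u v w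
      (by have := codim_le_maxCodim w; omega)]
    exact operator_congr (fullTerm_mem sel f _ u v w)
      fun u v w d' hd' => ih u v w d' (by omega)

theorem pathE_zero (c : Coeffs b J) (u w : MinRep b J)
    (g : ∀ v : MinRep b J, v ≠ w → DivRoot b J) : pathE b J sel c 0 u w g = 0 :=
  operator_apply_zero (pathTerm_mem sel g _ u) c

end Correctness

/-! ### Programs for linear recursions

Polynomials are represented by lists of monomials with signs, and families of polynomials that are
indexed by states and multidegrees by lists of terms. -/

section Programs

/-- A monomial, given by its exponents, with a sign (`true` for `-1`). -/
abbrev SignedMono (m : ℕ) : Type := (Fin m → ℕ) × Bool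

/-- A signed monomial in the component of a state and a multidegree. -/
abbrev StateTerm (σ : Type) (k m : ℕ) : Type := (σ × (Fin k → ℕ)) × SignedMono m

/-- A transition from a state: a new state, a shift of the multidegree, and a factor. -/
abbrev Transition (σ : Type) (k m : ℕ) : Type := σ × StateTerm σ k m

variable {σ : Type} {k m : ℕ}

/-- The product of signed monomials. -/
def mulMono (μ ν : SignedMono m) : SignedMono m := (μ.1 + ν.1, xor μ.2 ν.2)

/-- The result of a transition, if it applies. -/
def applyTransition [DecidableEq σ] (τ : Transition σ k m) (t : StateTerm σ k m) :
    Option (StateTerm σ k m) :=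
  if t.1.1 = τ.1 then some ((τ.2.1.1, τ.2.1.2 + t.1.2), mulMono τ.2.2 t.2) else none

/-- All results of transitions. -/
def transitionStep [DecidableEq σ] (T : List (Transition σ k m)) (L : List (StateTerm σ k m)) :
    List (StateTerm σ k m) :=
  T.flatMap fun τ => L.filterMap (applyTransition τ)

/-- The terms reached from the terms in `L₀` in fewer than `n` steps. -/
def reachable [DecidableEq σ] (L₀ : List (StateTerm σ k m)) (T : List (Transition σ k m)) (n : ℕ) :
    List (StateTerm σ k m) :=
  Nat.rec [] (fun _ L => L₀ ++ transitionStep T L) n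

/-- The component of a list of terms. -/
def component [DecidableEq σ] (L : List (StateTerm σ k m)) (s : σ) (d : Fin k → ℕ) :
    List (SignedMono m) :=
  L.filterMap fun t => if t.1 = (s, d) then some t.2 else none

/-- The powers of a polynomial. -/
def powMono (L : List (SignedMono m)) (n : ℕ) : List (SignedMono m) :=
  Nat.rec [(0, false)] (fun _ L' => L.flatMap fun μ => L'.map (mulMono μ)) n

/-- The term of a polynomial code for a signed monomial. -/
def monoCode (μ : SignedMono m) : (Fin m → ℕ) × ℤ := (μ.1, bif μ.2 then -1 else 1)

theorem primrec_add_fun {n : ℕ} : Primrec₂ fun a a' : Fin n → ℕ => a + a' := by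
  refine Primrec.fin_curry.mpr ?_
  refine Primrec.nat_add.comp
    (Primrec.fin_app.comp (Primrec.fst.comp Primrec.fst) Primrec.snd)
    (Primrec.fin_app.comp (Primrec.snd.comp Primrec.fst) Primrec.snd)

theorem primrec_sum_fun {n : ℕ} : Primrec fun a : Fin n → ℕ => ∑ i, a i := by
  induction (Finset.univ : Finset (Fin n)) using Finset.induction_on with
  | empty => simpa using Primrec.const 0
  | insert i s hi ih =>
    simp only [Finset.sum_insert hi]
    exact Primrec.nat_add.comp (Primrec.fin_app.comp Primrec.id (Primrec.const i)) ih

theorem primrec_mulMono : Primrec₂ (mulMono (m := m)) := by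
  refine Primrec.pair ?_ ?_
  · exact primrec_add_fun.comp (Primrec.fst.comp Primrec.fst) (Primrec.fst.comp Primrec.snd)
  · exact (Primrec.dom_finite fun p : Bool × Bool => xor p.1 p.2).comp
      (Primrec.pair (Primrec.snd.comp Primrec.fst) (Primrec.snd.comp Primrec.snd))

theorem primrec_monoCode : Primrec (monoCode (m := m)) :=
  Primrec.pair Primrec.fst
    ((Primrec.dom_finite fun x : Bool => (bif x then -1 else 1 : ℤ)).comp Primrec.snd)

theorem primrec_powMono (L : List (SignedMono m)) : Primrec (powMono L) := by
  refine Primrec.nat_rec₁ _ ?_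
  refine Primrec.list_flatMap (Primrec.const L) ?_
  exact Primrec.list_map (Primrec.snd.comp Primrec.fst)
    (primrec_mulMono.comp (Primrec.snd.comp Primrec.fst) Primrec.snd)

variable [DecidableEq σ]

section

variable [Primcodable σ]

theorem primrec_applyTransition : Primrec₂ (applyTransition (σ := σ) (k := k) (m := m)) := by
  refine Primrec.ite ?_ ?_ (Primrec.const none)
  · exact Primrec.eq.comp (Primrec.fst.comp (Primrec.fst.comp Primrec.snd))
      (Primrec.fst.comp Primrec.fst)
  · have hτ : Primrec fun p : Transition σ k m × StateTerm σ k m => p.1.2 :=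
      Primrec.snd.comp Primrec.fst
    have ht : Primrec fun p : Transition σ k m × StateTerm σ k m => p.2 := Primrec.snd
    refine Primrec.option_some.comp (Primrec.pair (Primrec.pair ?_ ?_) ?_)
    · exact Primrec.fst.comp (Primrec.fst.comp hτ)
    · exact primrec_add_fun.comp (Primrec.snd.comp (Primrec.fst.comp hτ))
        (Primrec.snd.comp (Primrec.fst.comp ht))
    · exact primrec_mulMono.comp (Primrec.snd.comp hτ) (Primrec.snd.comp ht)

theorem primrec_transitionStep (T : List (Transition σ k m)) : Primrec (transitionStep T) := by
  refine Primrec.list_flatMap (Primrec.const T) ?_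
  exact Primrec.listFilterMap Primrec.fst
    (primrec_applyTransition.comp (Primrec.snd.comp Primrec.fst) Primrec.snd)

theorem primrec_reachable (L₀ : List (StateTerm σ k m)) (T : List (Transition σ k m)) :
    Primrec (reachable L₀ T) :=
  Primrec.nat_rec₁ _ (Primrec.list_append.comp (Primrec.const L₀)
    ((primrec_transitionStep T).comp Primrec.snd))

theorem primrec_component : Primrec fun p : List (StateTerm σ k m) × (σ × (Fin k → ℕ)) =>
    component p.1 p.2.1 p.2.2 := by
  refine Primrec.listFilterMap Primrec.fst ?_
  refine Primrec.ite ?_ (Primrec.option_some.comp (Primrec.snd.comp Primrec.snd))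
    (Primrec.const none)
  exact Primrec.eq.comp (Primrec.fst.comp Primrec.snd) (Primrec.snd.comp Primrec.fst)

end

variable {K : Type*} [CommRing K] (X : Fin m → K)

/-- The value of a signed monomial. -/
def monoVal (μ : SignedMono m) : K := (bif μ.2 then -1 else 1) * ∏ i, X i ^ μ.1 i

/-- The value of a list of signed monomials. -/
def listVal (L : List (SignedMono m)) : K := (L.map (monoVal X)).sum

theorem monoVal_mul (μ ν : SignedMono m) :
    monoVal X (mulMono μ ν) = monoVal X μ * monoVal X ν := by
  obtain ⟨a, s⟩ := μ
  obtain ⟨a', s'⟩ := ν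
  simp only [monoVal, mulMono, Pi.add_apply, pow_add, Finset.prod_mul_distrib]
  cases s <;> cases s' <;> simp

theorem listVal_map_mulMono (μ : SignedMono m) (L : List (SignedMono m)) :
    listVal X (L.map (mulMono μ)) = monoVal X μ * listVal X L := by
  simp only [listVal, List.map_map]
  rw [← List.sum_map_mul_left]
  congr 1
  exact List.map_congr_left fun ν _ => monoVal_mul X μ ν

theorem sum_map_flatMap {A B : Type*} (l : List A) (g : A → List B) (h : B → K) :
    ((l.flatMap g).map h).sum = (l.map fun a => ((g a).map h).sum).sum := by
  induction l with
  | nil => simp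
  | cons a l ih => simp [ih]

theorem listVal_powMono (L : List (SignedMono m)) (n : ℕ) :
    listVal X (powMono L n) = listVal X L ^ n := by
  induction n with
  | zero => simp [powMono, listVal, monoVal]
  | succ n ih =>
    change listVal X (L.flatMap fun μ => (powMono L n).map (mulMono μ)) = _
    rw [listVal, sum_map_flatMap]
    have h : ∀ μ, (((powMono L n).map (mulMono μ)).map (monoVal X)).sum =
        monoVal X μ * listVal X L ^ n := fun μ => by
      rw [← ih, ← listVal_map_mulMono]; rfl
    simp only [h]
    rw [List.sum_map_mul_right, pow_succ']
    rfl

theorem listVal_component_nil (s : σ) (d : Fin k → ℕ) :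
    listVal X (component ([] : List (StateTerm σ k m)) s d) = 0 := by
  simp [component, listVal]

theorem listVal_component_cons (t : StateTerm σ k m) (L : List (StateTerm σ k m)) (s : σ)
    (d : Fin k → ℕ) : listVal X (component (t :: L) s d) =
      (if t.1 = (s, d) then monoVal X t.2 else 0) + listVal X (component L s d) := by
  simp only [component, listVal, List.filterMap_cons]
  split_ifs with h <;> simp

theorem listVal_component_append (L L' : List (StateTerm σ k m)) (s : σ) (d : Fin k → ℕ) :
    listVal X (component (L ++ L') s d) =
      listVal X (component L s d) + listVal X (component L' s d) := by
  simp [component, listVal, List.filterMap_append]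

/-- The operator of a list of transitions. -/
def transitionOp (T : List (Transition σ k m)) (y : σ → (Fin k → ℕ) → K) (s : σ)
    (d : Fin k → ℕ) : K :=
  (T.map fun τ => if τ.2.1.1 = s ∧ τ.2.1.2 ≤ d then
    monoVal X τ.2.2 * y τ.1 (d - τ.2.1.2) else 0).sum

/-- Adding the shift to exponents of the multidegree in a list corresponds to evaluating at $d$
minus the shift, and no term reaches $d$ unless the shift is at most $d$. -/
theorem listVal_component_filterMap (τ : Transition σ k m) (L : List (StateTerm σ k m)) (s : σ)
    (d : Fin k → ℕ) : listVal X (component (L.filterMap (applyTransition τ)) s d) =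
      if τ.2.1.1 = s ∧ τ.2.1.2 ≤ d then
        monoVal X τ.2.2 * listVal X (component L τ.1 (d - τ.2.1.2)) else 0 := by
  induction L with
  | nil => simp [listVal_component_nil]
  | cons t L ih =>
    rw [List.filterMap_cons, listVal_component_cons]
    have hadd : ∀ e : Fin k → ℕ, τ.2.1.2 ≤ d → (τ.2.1.2 + e = d ↔ e = d - τ.2.1.2) := by
      intro e he
      constructor
      · rintro rfl; simp
      · rintro rfl; exact add_tsub_cancel_of_le he
    have hle : ∀ e : Fin k → ℕ, τ.2.1.2 + e = d → τ.2.1.2 ≤ d := by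
      rintro e rfl
      exact le_self_add
    unfold applyTransition at ih ⊢
    by_cases h1 : t.1.1 = τ.1
    · simp only [h1, if_true]
      rw [listVal_component_cons, ih, monoVal_mul]
      by_cases h2 : τ.2.1.1 = s ∧ τ.2.1.2 ≤ d
      · rw [if_pos h2, if_pos h2, mul_add]
        congr 1
        by_cases h3 : t.1.2 = d - τ.2.1.2
        · rw [if_pos, if_pos (Prod.ext h1 h3)]
          exact Prod.ext h2.1 ((hadd _ h2.2).mpr h3)
        · rw [if_neg, if_neg, mul_zero]
          · exact fun h => h3 (congrArg Prod.snd h)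
          · exact fun h => h3 ((hadd _ h2.2).mp (congrArg Prod.snd h))
      · rw [if_neg h2, if_neg h2, if_neg, add_zero]
        exact fun h => h2 ⟨congrArg Prod.fst h, hle _ (congrArg Prod.snd h)⟩
    · simp only [h1, if_false]
      rw [ih, if_neg (c := t.1 = _) fun h => h1 (congrArg Prod.fst h), zero_add]

theorem listVal_component_transitionStep (T : List (Transition σ k m))
    (L : List (StateTerm σ k m)) (s : σ) (d : Fin k → ℕ) :
    listVal X (component (transitionStep T L) s d) =
      transitionOp X T (fun s d => listVal X (component L s d)) s d := by
  induction T with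
  | nil => simp [transitionStep, transitionOp, listVal_component_nil]
  | cons τ T ih =>
    have h : transitionStep (τ :: T) L = L.filterMap (applyTransition τ) ++ transitionStep T L := by
      simp [transitionStep]
    rw [h, listVal_component_append, ih, listVal_component_filterMap]
    simp [transitionOp]

/-- A solution of the linear recursion given by transitions is computed by the reachable terms. -/
theorem listVal_component_reachable {L₀ : List (StateTerm σ k m)} {T : List (Transition σ k m)}
    (hT : ∀ τ ∈ T, τ.2.1.2 ≠ 0) {y : σ → (Fin k → ℕ) → K}
    (hy : ∀ s d, y s d = listVal X (component L₀ s d) + transitionOp X T y s d) (n : ℕ) :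
    ∀ s d, ∑ i, d i < n → listVal X (component (reachable L₀ T n) s d) = y s d := by
  induction n with
  | zero => intro s d h; omega
  | succ n ih =>
    intro s d h
    change listVal X (component (L₀ ++ transitionStep T (reachable L₀ T n)) s d) = _
    rw [listVal_component_append, listVal_component_transitionStep, hy]
    refine congrArg₂ (· + ·) rfl (congrArg List.sum (List.map_congr_left fun τ hτ => ?_))
    split_ifs with h1
    · beta_reduce
      rw [ih]
      have := sum_tsub_lt (hT τ hτ) h1.2
      omega
    · rfl

end Programs

/-! ### Clearing denominators -/

section Denominators

variable {ι M N : Type*} [Fintype ι] [AddCommGroup M] [Module ℚ M] [AddCommGroup N] [Module ℚ N]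
  {P : RootPairing ι ℚ M N} [P.IsRootSystem] [P.IsCrystallographic] [P.IsReduced]
  {b : P.Base} {m : ℕ} (e : Fin m ≃ b.support)

theorem algebraMap_decodePoly (L : List (SignedMono m)) :
    algebraMap _ (RatFun b) (decodePoly b e (L.map monoCode)) =
      listVal (fun i => negRoot b (e i)) L := by
  rw [decodePoly, listVal, List.map_map, map_list_sum, List.map_map]
  congr 1
  refine List.map_congr_left fun μ _ => ?_
  simp only [Function.comp_apply, monoCode, monoVal, map_mul, map_prod, map_pow, negRoot]
  congr 1
  cases μ.2 <;> simp

theorem exists_listVal_eq (p : MvPolynomial b.support ℤ) :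
    ∃ L : List (SignedMono m),
      listVal (fun i => negRoot b (e i)) L = algebraMap _ (RatFun b) p := by
  -- The representable values form a subgroup, since a sign can be flipped on each monomial. An
  -- integer coefficient is thus obtained by repeating a monomial.
  set S : AddSubgroup (RatFun b) :=
    { carrier := {x | ∃ L : List (SignedMono m), listVal (fun i => negRoot b (e i)) L = x}
      zero_mem' := ⟨[], by simp [listVal]⟩
      add_mem' := by
        rintro _ _ ⟨L, rfl⟩ ⟨L', rfl⟩
        exact ⟨L ++ L', by simp [listVal]⟩
      neg_mem' := by
        rintro _ ⟨L, rfl⟩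
        refine ⟨L.map (mulMono (0, true)), ?_⟩
        rw [listVal_map_mulMono]
        simp [monoVal] } with hS
  have hmem : ∀ L : List (SignedMono m), listVal (fun i => negRoot b (e i)) L ∈ S :=
    fun L => ⟨L, rfl⟩
  change algebraMap _ (RatFun b) p ∈ S
  rw [p.as_sum, map_sum]
  refine sum_mem fun a _ => ?_
  have h : algebraMap _ (RatFun b) (MvPolynomial.monomial a (p.coeff a)) =
      p.coeff a • listVal (fun i => negRoot b (e i)) [(fun i => a (e i), false)] := by
    rw [MvPolynomial.monomial_eq, Finsupp.prod_fintype _ _ (by simp)]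
    simp only [map_mul, map_prod, map_pow, listVal, monoVal, List.map_cons, List.map_nil,
      List.sum_cons, List.sum_nil, add_zero, zsmul_eq_mul, cond_false, one_mul]
    congr 1
    · simp
    · rw [← e.prod_comp]; rfl
  rw [h]
  exact AddSubgroup.zsmul_mem _ (hmem _) _

/-- The solution of a linear recursion over `R(Λ)` is given by a computable function. -/
theorem exists_computable_of_recursion {σ I : Type*} {k r : ℕ} [Fintype σ]
    (num : σ ≃ Fin r × Fin r × Fin r) (x : σ → (Fin k → ℕ) → RatFun b)
    (κ : σ → RatFun b) (S : σ → Finset I) (A : σ → I → RatFun b) (δ : I → Fin k → ℕ)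
    (src : I → σ) (hδ : ∀ i, δ i ≠ 0)
    (hx : ∀ s d, x s d = κ s * (if d = 0 then 1 else 0) +
      ∑ i ∈ S s, A s i * (if δ i ≤ d then x (src i) (d - δ i) else 0)) :
    ∃ prog : Fin r × Fin r × Fin r × (Fin k → ℕ) → PolyCode m × PolyCode m,
      Computable prog ∧ ∀ (u v w : Fin r) (d : Fin k → ℕ),
        decodePoly b e (prog (u, v, w, d)).2 ≠ 0 ∧
        x (num.symm (u, v, w)) d =
          algebraMap _ (RatFun b) (decodePoly b e (prog (u, v, w, d)).1) /
            algebraMap _ (RatFun b) (decodePoly b e (prog (u, v, w, d)).2) := by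
  set X : Fin m → RatFun b := fun i => negRoot b (e i) with hX
  -- One common denominator for the finitely many constants of the recursion. They are fixed data of
  -- the program and need not be computed by it.
  obtain ⟨D, hD⟩ := IsLocalization.exist_integer_multiples_of_finite
    (nonZeroDivisors (MvPolynomial b.support ℤ))
    (fun z : Σ s : σ, Option (S s) => z.2.elim (κ z.1) fun i => A z.1 i)
  have hD0 : algebraMap _ (RatFun b) (D : MvPolynomial b.support ℤ) ≠ 0 :=
    IsFractionRing.to_map_ne_zero_of_mem_nonZeroDivisors D.2
  set D' := algebraMap _ (RatFun b) (D : MvPolynomial b.support ℤ) with hD'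
  obtain ⟨LD, hLD⟩ := exists_listVal_eq e (D : MvPolynomial b.support ℤ)
  have hκ : ∀ s, ∃ L, listVal X L = D' * κ s := by
    intro s
    obtain ⟨p, hp⟩ := hD ⟨s, none⟩
    obtain ⟨L, hL⟩ := exists_listVal_eq e p
    exact ⟨L, by rw [hL, hp, Algebra.smul_def]; rfl⟩
  -- For $y_d=D^{|d|+1}x_d$ a shift by $\delta$ acquires the factor
  -- $D^{|\delta|}A=(DA)D^{|\delta|-1}$. It is a polynomial because $|\delta|\ge1$, so the truncated
  -- subtraction is harmless.
  have hA : ∀ s i, ∃ L, i ∈ S s → listVal X L = D' * A s i * D' ^ (∑ j, δ i j - 1) := by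
    intro s i
    by_cases hi : i ∈ S s
    · obtain ⟨p, hp⟩ := hD ⟨s, some ⟨i, hi⟩⟩
      obtain ⟨L, hL⟩ := exists_listVal_eq e (p * (D : MvPolynomial b.support ℤ) ^ (∑ j, δ i j - 1))
      refine ⟨L, fun _ => ?_⟩
      rw [hL, map_mul, map_pow, hp, Algebra.smul_def]
      rfl
    · exact ⟨[], fun h => absurd h hi⟩
  choose Lκ hκ using hκ
  choose LA hA using hA
  set L₀ : List (StateTerm (Fin r × Fin r × Fin r) k m) :=
    Finset.univ.toList.flatMap fun s : σ => (Lκ s).map fun μ => ((num s, 0), μ) with hL₀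
  set T : List (Transition (Fin r × Fin r × Fin r) k m) :=
    Finset.univ.toList.flatMap fun s : σ => (S s).toList.flatMap fun i =>
      (LA s i).map fun μ => (num (src i), ((num s, δ i), μ)) with hT
  have hT0 : ∀ τ ∈ T, τ.2.1.2 ≠ 0 := by
    intro τ hτ
    simp only [hT, List.mem_flatMap, List.mem_map] at hτ
    obtain ⟨s, -, i, -, μ, -, rfl⟩ := hτ
    exact hδ i
  set y : Fin r × Fin r × Fin r → (Fin k → ℕ) → RatFun b :=
    fun s d => D' ^ (∑ j, d j + 1) * x (num.symm s) d with hy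
  have hval₀ : ∀ s d, listVal X (component L₀ (num s) d) =
      D' * κ s * (if d = 0 then 1 else 0) := by
    intro s d
    have h1 : ∀ L : List (StateTerm (Fin r × Fin r × Fin r) k m),
        listVal X (component L (num s) d) =
          (L.map fun t => if t.1 = (num s, d) then monoVal X t.2 else 0).sum := by
      intro L
      induction L with
      | nil => exact listVal_component_nil X _ _
      | cons t L ih => rw [listVal_component_cons, ih]; simp
    rw [h1, hL₀, sum_map_flatMap, Finset.sum_map_toList, Finset.sum_eq_single s]
    · rw [List.map_map, ← hκ]
      by_cases hd : d = 0
      · subst hd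
        simp [listVal, Function.comp_def]
      · simp [Function.comp_def, hd, Ne.symm hd]
    · intro s' _ hs'
      simp [Function.comp_def, hs']
    · simp
  have hvalT : ∀ s d, transitionOp X T y (num s) d =
      ∑ i ∈ S s, if δ i ≤ d then
        D' * A s i * D' ^ (∑ j, δ i j - 1) * y (num (src i)) (d - δ i) else 0 := by
    intro s d
    rw [transitionOp, hT, sum_map_flatMap, Finset.sum_map_toList, Finset.sum_eq_single s]
    · rw [sum_map_flatMap, Finset.sum_map_toList]
      refine Finset.sum_congr rfl fun i hi => ?_
      rw [List.map_map, ← hA s i hi]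
      by_cases hd : δ i ≤ d
      · simp only [Function.comp_def, hd, and_self, if_true]
        rw [List.sum_map_mul_right]
        rfl
      · simp [Function.comp_def, hd]
    · intro s' _ hs'
      rw [sum_map_flatMap, Finset.sum_map_toList]
      refine Finset.sum_eq_zero fun i _ => ?_
      simp [Function.comp_def, hs']
    · simp
  have hyrec : ∀ s d, y s d = listVal X (component L₀ s d) + transitionOp X T y s d := by
    intro s d
    obtain ⟨s, rfl⟩ := num.surjective s
    rw [hval₀, hvalT, hy]
    simp only [Equiv.symm_apply_apply]
    rw [hx s d, mul_add, Finset.mul_sum]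
    congr 1
    · split_ifs with hd
      · subst hd; simp
      · simp
    · refine Finset.sum_congr rfl fun i _ => ?_
      split_ifs with hd
      · have h1 : ∑ j, (d - δ i) j + ∑ j, δ i j = ∑ j, d j := by
          rw [← Finset.sum_add_distrib]
          exact Finset.sum_congr rfl fun j _ => Nat.sub_add_cancel (hd j)
        have h2 : ∑ j, δ i j ≠ 0 := by
          intro h0
          apply hδ i
          funext j
          exact Finset.sum_eq_zero_iff.mp h0 j (Finset.mem_univ j)
        have h3 : ∑ j, d j + 1 = 1 + (∑ j, δ i j - 1) + (∑ j, (d - δ i) j + 1) := by omega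
        rw [h3, pow_add, pow_add, pow_one]
        ring
      · simp
  -- The numerator is $y_d$ and the denominator is $D^{|d|+1}$. As every transition raises the total
  -- multidegree, $|d|+1$ rounds suffice.
  refine ⟨fun p => ((component (reachable L₀ T (∑ j, p.2.2.2 j + 1)) (p.1, p.2.1, p.2.2.1)
    p.2.2.2).map monoCode, (powMono LD (∑ j, p.2.2.2 j + 1)).map monoCode), ?_, ?_⟩
  · refine Primrec.to_comp ?_
    have hd : Primrec fun p : Fin r × Fin r × Fin r × (Fin k → ℕ) => p.2.2.2 :=
      Primrec.snd.comp (Primrec.snd.comp Primrec.snd)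
    have hn : Primrec fun p : Fin r × Fin r × Fin r × (Fin k → ℕ) => ∑ j, p.2.2.2 j + 1 :=
      Primrec.succ.comp (primrec_sum_fun.comp hd)
    have hs : Primrec fun p : Fin r × Fin r × Fin r × (Fin k → ℕ) => (p.1, p.2.1, p.2.2.1) :=
      Primrec.pair Primrec.fst (Primrec.pair (Primrec.fst.comp Primrec.snd)
        (Primrec.fst.comp (Primrec.snd.comp Primrec.snd)))
    refine Primrec.pair (Primrec.list_map ?_ (primrec_monoCode.comp Primrec.snd))
      (Primrec.list_map ((primrec_powMono LD).comp hn) (primrec_monoCode.comp Primrec.snd))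
    exact primrec_component.comp
      (Primrec.pair ((primrec_reachable L₀ T).comp hn) (Primrec.pair hs hd))
  · intro u v w d
    have hden : algebraMap _ (RatFun b)
        (decodePoly b e ((powMono LD (∑ j, d j + 1)).map monoCode)) = D' ^ (∑ j, d j + 1) := by
      rw [algebraMap_decodePoly, listVal_powMono, hLD]
    refine ⟨fun h0 => ?_, ?_⟩
    · simp only at h0
      rw [h0, map_zero] at hden
      exact pow_ne_zero _ hD0 hden.symm
    · simp only
      rw [hden, algebraMap_decodePoly,
        listVal_component_reachable _ hT0 hyrec _ _ _ (Nat.lt_succ_self _), hy,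
        mul_div_cancel_left₀ _ (pow_ne_zero _ hD0)]

end Denominators

/-! ### Effectivity of the algorithm -/

section Effective

variable {ι M N : Type*} [Fintype ι] [AddCommGroup M] [Module ℚ M] [AddCommGroup N] [Module ℚ N]
  {P : RootPairing ι ℚ M N} [P.IsRootSystem] [P.IsCrystallographic] [P.IsReduced]
  (b : P.Base) (J : Set b.support)

/-- By `fullTerm_mem` one round is, for each triple $(u,v,w)$, a finite combination of generators.
Applied to the output itself, which it fixes by `algorithm_eq`, it yields a recursion of the form
treated in `exists_computable_of_recursion`. -/
theorem isEffective_algorithm (sel : Selector b J) (f : Assignments b J) :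
    IsEffective b J (algorithm b J sel f) := by
  intro m k r eΔ eD eW
  have hspan : ∀ s : Triple b J, ∃ l : Option ({e : Deg b J // e ≠ 0} × Triple b J) →₀ RatFun b,
      (l.sum fun o a => a • generator b J o) =
        fun c d => fullTerm b J sel f c d (3 * maxCodim b J + 1) s.1 s.2.1 s.2.2 := fun s =>
    Finsupp.mem_span_range_iff_exists_finsupp.mp (fullTerm_mem sel f _ s.1 s.2.1 s.2.2)
  choose l hl using hspan
  have hrec : ∀ (s : Triple b J) (d : Deg b J), algorithm b J sel f s.1 s.2.1 s.2.2 d =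
      l s none * (if d = 0 then 1 else 0) + ∑ i ∈ (l s).some.support, (l s).some i *
        (if i.1.1 ≤ d then algorithm b J sel f i.2.1 i.2.2.1 i.2.2.2 (d - i.1.1) else 0) := by
    intro s d
    have h1 := congrFun (congrFun (hl s) (algorithm b J sel f)) d
    rw [algorithm_eq, ← h1, Finsupp.sum_option_index _ _ (by simp) (by simp [add_smul]),
      Finsupp.sum]
    simp only [Pi.add_apply, Pi.smul_apply, Finset.sum_apply, smul_eq_mul]
    rfl
  have hnum := exists_computable_of_recursion eΔ
    (num := (eW.prodCongr (eW.prodCongr eW)).symm)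
    (x := fun s d => algorithm b J sel f s.1 s.2.1 s.2.2 (d ∘ eD.symm))
    (κ := fun s => l s none) (S := fun s => (l s).some.support) (A := fun s i => (l s).some i)
    (δ := fun i => i.1.1 ∘ eD) (src := fun i => i.2) ?_ ?_
  · obtain ⟨prog, h1, h2⟩ := hnum
    exact ⟨prog, h1, h2⟩
  · intro i h
    apply i.1.2
    funext β
    simpa using congrFun h (eD.symm β)
  · intro s d
    have h0 : d ∘ eD.symm = 0 ↔ d = 0 := by
      constructor
      · intro h
        funext j
        simpa using congrFun h (eD j)
      · rintro rfl; rfl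
    have hle : ∀ a : Deg b J, a ≤ d ∘ eD.symm ↔ a ∘ eD ≤ d := by
      intro a
      constructor
      · intro h j
        simpa using h (eD j)
      · intro h β
        simpa using h (eD.symm β)
    have hsub : ∀ a : Deg b J, (d - a ∘ eD) ∘ eD.symm = d ∘ eD.symm - a := by
      intro a
      funext β
      simp
    simp only [hrec s (d ∘ eD.symm), h0, hle, hsub]

end Effective

end

end EQLR

theorem theorem2 {ι M N : Type*} [Fintype ι] [AddCommGroup M] [Module ℚ M] [AddCommGroup N]
    [Module ℚ N] (P : RootPairing ι ℚ M N) [P.IsRootSystem] [P.IsCrystallographic] [P.IsReduced]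
    (b : P.Base) (J : Set b.support) :
    -- the properties determine the coefficients uniquely
    (∀ c c' : EQLR.Coeffs b J, EQLR.IsEQLR b J c → EQLR.IsEQLR b J c' → c = c') ∧
    -- the choices that the algorithm needs can be made
    (∃ sel : EQLR.Selector b J, EQLR.IsSelector b J sel) ∧
    (∃ f : EQLR.Assignments b J, EQLR.IsGoodAssignments b J f) ∧
    -- for all such choices the algorithm is effective and computes the coefficients
    (∀ (sel : EQLR.Selector b J) (f : EQLR.Assignments b J),
      EQLR.IsSelector b J sel → EQLR.IsGoodAssignments b J f →
      EQLR.IsEffective b J (EQLR.algorithm b J sel f) ∧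
      ∀ c : EQLR.Coeffs b J, EQLR.IsEQLR b J c →
        c = EQLR.algorithm b J sel f ∧
        (∀ w, c w w w 0 = 1 / EQLR.pathSum b J (EQLR.unitRep b J) w (f w)) ∧
        (∀ w d, c w w w d =
          ((if d = 0 then 1 else 0) - EQLR.pathE b J sel c d (EQLR.unitRep b J) w (f w)) /
            EQLR.pathSum b J (EQLR.unitRep b J) w (f w))) := by
  obtain ⟨sel, hsel⟩ := EQLR.exists_isSelector b J
  obtain ⟨f, hf⟩ := EQLR.exists_isGoodAssignments b J
  refine ⟨fun c c' hc hc' => ?_, ⟨sel, hsel⟩, ⟨f, hf⟩, fun sel f hsel hf =>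
    ⟨EQLR.isEffective_algorithm b J sel f, fun c hc =>
      ⟨hc.eq_algorithm hsel hf, fun w => ?_, fun w d => ?_⟩⟩⟩
  · rw [hc.eq_algorithm hsel hf, hc'.eq_algorithm hsel hf]
  · rw [← EQLR.diagValue_eq hc hsel hf, EQLR.diagValue, if_pos rfl, EQLR.pathE_zero, sub_zero]
  · rw [← EQLR.diagValue_eq hc hsel hf, EQLR.diagValue]
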